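/- Let $K$ be a field of characteristic zero, let $R = K[X_1,\ldots,X_n]$ with partial derivatives $\partial_i = \partial/\partial X_i$, and let $L \supseteq K$ be an algebraically closed field. Let $I \subset R$ be a zero-dimensional ideal, that is, an ideal such that the length of $R/I$ is finite and non-zero, and let $$V(I)_L = \{\mathbf a \in L^n \mid f(\mathbf a) = 0 \text{ for all } f \in I\}.$$ Let $H^n_I(R)$ be the $n$-th local cohomology module of $R$ with respect to $I$; for any generators $f_1,\ldots,f_s$ of $I$ it is the $n$-th cohomology of the Čech complex $$0 \to R \to \bigoplus_i R_{f_i} \to \bigoplus_{i<j} R_{f_if_j} \to \cdots \to R_{f_1\cdots f_s} \to 0,$$ and $\partial_1,\ldots,\partial_n$ act on it through their extensions (by the quotient rule) to the localizations of $R$. For a $K$-vector space $N$ with commuting operators $\partial_1,\ldots,\partial_n$ let $H^i(\partial; N)$ denote the $i$-th cohomology of the de Rham complex of $N$, whose term in degree $p$ is $\bigoplus_{j_1<\cdots<j_p} N\, dX_{j_1}\wedge\cdots\wedge dX_{j_p}$ and whose differential is $\omega \mapsto \sum_i dX_i \wedge \partial_i\omega$. Then $H^i(\partial; H^n_I(R))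 = 0$ for all $i < n$, the set $V(I)_L$ and the dimension of $H^n(\partial; H^n_I(R))$ are finite, and $$\dim_K H^n(\partial; H^n_I(R)) = \sharp V(I)_L .$$ -/

import Mathlib

universe u v

noncomputable section

namespace DeRhamLC

/-! ### Cohomology of a sequence of linear maps -/

section Cohomology

variable {K : Type u} [Field K] {C : ℕ → Type u} [∀ p, AddCommGroup (C p)] [∀ p, Module K (C p)]

/-- The coboundaries in degree `p`: zero in degree `0`, and the image of `d (p - 1)` for `p ≥ 1`. -/
def coboundaries (d : ∀ p, C p →ₗ[K] C (p + 1)) : ∀ p, Submodule K (C p)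
  | 0 => ⊥
  | p + 1 => LinearMap.range (d p)

/-- The `p`-th cohomology `ker d^p / im d^{p-1}` of the cochain complex
`0 → C 0 → C 1 → C 2 → ⋯`. -/
abbrev Cohomology (d : ∀ p, C p →ₗ[K] C (p + 1)) (p : ℕ) : Type u :=
  LinearMap.ker (d p) ⧸ (coboundaries d p).submoduleOf (LinearMap.ker (d p))

/-- The endomorphism of cohomology induced by an endomorphism of a cochain complex. -/
def Cohomology.map (d : ∀ p, C p →ₗ[K] C (p + 1)) (θ : ∀ p, C p →ₗ[K] C p)
    (h : ∀ p c, d p (θ p c) = θ (p + 1) (d p c)) (p : ℕ) :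
    Cohomology d p →ₗ[K] Cohomology d p :=
  Submodule.mapQ _ _
    ((θ p).restrict (p := LinearMap.ker (d p)) (q := LinearMap.ker (d p)) (by
      intro c hc
      rw [LinearMap.mem_ker] at hc ⊢
      rw [h, hc, map_zero]))
    (by
      rintro ⟨c, hc⟩ hcb
      cases p with
      | zero =>
        have hc0 : c = 0 := hcb
        change θ 0 c = 0
        rw [hc0, map_zero]
      | succ p =>
        obtain ⟨b, hb⟩ : ∃ b, d p b = c := hcb
        exact ⟨θ p b, by rw [h, hb]; rfl⟩)

end Cohomology

/-! ### Alternating cochains indexed by subsets -/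

/-- The subsets of `{0, …, s - 1}` with exactly `p` elements. -/
abbrev Subsets (s p : ℕ) : Type := {S : Finset (Fin s) // S.card = p}

/-- The `p`-element set `T \ {i}`, for a `(p + 1)`-element set `T` and `i ∈ T`. -/
abbrev Subsets.erase {s p : ℕ} (T : Subsets s (p + 1)) (i : {i // i ∈ T.1}) : Subsets s p :=
  ⟨T.1.erase i.1, by rw [Finset.card_erase_of_mem i.2, T.2, Nat.add_sub_cancel]⟩

/-- The sign `(-1) ^ #{j ∈ T | j < i}`. -/
def sgn (K : Type u) [Field K] {s : ℕ} (T : Finset (Fin s)) (i : Fin s) : K :=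
  (-1) ^ (T.filter (· < i)).card

/-- Given modules `A S` for `S ⊆ {0, …, s - 1}` and maps `φ T i : A (T \ {i}) → A T` for `i ∈ T`,
the map `∏_{|S| = p} A S → ∏_{|T| = p + 1} A T` with
`(d c)_T = ∑_{i ∈ T} (-1) ^ #{j ∈ T | j < i} φ T i (c_{T \ {i}})`. -/
def altDiff {K : Type u} [Field K] {s : ℕ} (A : Finset (Fin s) → Type u)
    [∀ S, AddCommGroup (A S)] [∀ S, Module K (A S)]
    (φ : ∀ (T : Finset (Fin s)) (i : {i // i ∈ T}), A (T.erase i.1) →ₗ[K] A T) (p : ℕ) :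
    (∀ S : Subsets s p, A S.1) →ₗ[K] (∀ T : Subsets s (p + 1), A T.1) where
  toFun c T := ∑ i : {i // i ∈ T.1}, sgn K T.1 i.1 • φ T.1 i (c (T.erase i))
  map_add' c c' := by
    funext T
    simp [Finset.sum_add_distrib]
  map_smul' r c := by
    funext T
    simp [Finset.smul_sum, smul_comm r]

/-! ### The de Rham complex -/

/-- The differential of the de Rham complex `K(∂; N)` of a `K`-vector space `N` with operators
`∂_1, …, ∂_n`: a `p`-cochain `ω = (ω_S)_{|S| = p}` stands for `∑_S ω_S dx_S`, and
`(d ω)_T = ∑_{i ∈ T} (-1) ^ #{j ∈ T | j < i} ∂_i ω_{T \ {i}}`. -/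
def deRhamDiff {K : Type u} [Field K] {N : Type u} [AddCommGroup N] [Module K N] {n : ℕ}
    (del : Fin n → N →ₗ[K] N) (p : ℕ) :
    (Subsets n p → N) →ₗ[K] (Subsets n (p + 1) → N) :=
  altDiff (fun _ => N) (fun _ i => del i.1) p

/-- The de Rham cohomology `H^p(∂; N)`. -/
abbrev DeRhamCohomology {K : Type u} [Field K] {N : Type u} [AddCommGroup N] [Module K N] {n : ℕ}
    (del : Fin n → N →ₗ[K] N) (p : ℕ) : Type u :=
  Cohomology (C := fun p => Subsets n p → N) (deRhamDiff del) p

/-! ### Extension of a derivation to a localization -/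

section Localization

variable {K R : Type u} [Field K] [CommRing R] [Algebra K R]

/-- The algebra map `R → R_g[ε]`, `a ↦ a + D(a) ε`, extended to `R_g`. -/
def awayDual (D : Derivation K R R) (g : R) :
    Localization.Away g →ₐ[K]
      TrivSqZeroExt (Localization.Away g) (Localization.Away g) :=
  IsLocalization.liftAlgHom (M := Submonoid.powers g)
    (f := ({ toFun := fun a =>
               (TrivSqZeroExt.inl (algebraMap R (Localization.Away g) a) +
                 TrivSqZeroExt.inr (algebraMap R (Localization.Away g) (D a)))
             map_one' := by ext <;> simp
             map_zero' := by ext <;> simp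
             map_add' := fun a b => by ext <;> simp [Algebra.smul_def]
             map_mul' := fun a b => by
               ext
               · simp
               · simp only [Derivation.leibniz, smul_eq_mul, map_mul, map_add,
                   TrivSqZeroExt.snd_mul, TrivSqZeroExt.snd_add, TrivSqZeroExt.fst_add,
                   TrivSqZeroExt.snd_inl, TrivSqZeroExt.snd_inr, TrivSqZeroExt.fst_inl,
                   TrivSqZeroExt.fst_inr, zero_add, add_zero, op_smul_eq_smul]
             commutes' := fun r => by
               rw [TrivSqZeroExt.algebraMap_eq_inl', Derivation.map_algebraMap, map_zero,
                 ← IsScalarTower.algebraMap_apply, TrivSqZeroExt.inr_zero, add_zero] } :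
        R →ₐ[K] TrivSqZeroExt (Localization.Away g) (Localization.Away g)))
    (by
      intro y
      rw [TrivSqZeroExt.isUnit_iff_isUnit_fst]
      simpa using IsLocalization.map_units (Localization.Away g) y)

theorem awayDual_algebraMap (D : Derivation K R R) (g a : R) :
    awayDual D g (algebraMap R (Localization.Away g) a) =
      TrivSqZeroExt.inl (algebraMap R (Localization.Away g) a) +
        TrivSqZeroExt.inr (algebraMap R (Localization.Away g) (D a)) := by
  simp [awayDual]

theorem fst_awayDual (D : Derivation K R R) (g : R) (x : Localization.Away g) :
    (awayDual D g x).fst = x := by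
  have h : ((TrivSqZeroExt.fstHom K (Localization.Away g) (Localization.Away g)).comp
      (awayDual D g) : Localization.Away g →+* Localization.Away g) = RingHom.id _ := by
    apply IsLocalization.ringHom_ext (Submonoid.powers g)
    ext a
    simp [awayDual_algebraMap]
  exact congrArg (fun ψ : Localization.Away g →+* Localization.Away g => ψ x) h

/-- The extension of a `K`-derivation `D` of `R` to `R_g = R[1/g]` (the quotient rule). -/
def awayDerivation (D : Derivation K R R) (g : R) :
    Derivation K (Localization.Away g) (Localization.Away g) :=
  Derivation.mk'
    ((TrivSqZeroExt.sndHom _ _).restrictScalars K ∘ₗ (awayDual D g).toLinearMap) (by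
      intro x y
      simp [fst_awayDual, mul_comm])

theorem awayDerivation_algebraMap (D : Derivation K R R) (g a : R) :
    awayDerivation D g (algebraMap R (Localization.Away g) a) =
      algebraMap R (Localization.Away g) (D a) := by
  change (awayDual D g (algebraMap R (Localization.Away g) a)).snd = _
  rw [awayDual_algebraMap, TrivSqZeroExt.snd_add, TrivSqZeroExt.snd_inl, TrivSqZeroExt.snd_inr,
    zero_add]

/-- The canonical map `R_g → R_h`, for `g` dividing `h`. -/
def awayMap {g h : R} (hgh : g ∣ h) : Localization.Away g →ₐ[K] Localization.Away h :=
  IsLocalization.liftAlgHom (M := Submonoid.powers g)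
    (f := IsScalarTower.toAlgHom K R (Localization.Away h)) (by
      rintro ⟨_, k, rfl⟩
      have hu : IsUnit (algebraMap R (Localization.Away h) h) :=
        IsLocalization.Away.algebraMap_isUnit h
      simpa using (isUnit_of_dvd_unit (map_dvd _ hgh) hu).pow k)

theorem awayMap_algebraMap {g h : R} (hgh : g ∣ h) (a : R) :
    awayMap (K := K) hgh (algebraMap R (Localization.Away g) a) =
      algebraMap R (Localization.Away h) a := by
  simp [awayMap]

/-- The canonical maps between localizations commute with the extended derivations. -/
theorem awayMap_awayDerivation (D : Derivation K R R) {g h : R} (hgh : g ∣ h)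
    (x : Localization.Away g) :
    awayMap (K := K) hgh (awayDerivation D g x) = awayDerivation D h (awayMap (K := K) hgh x) := by
  obtain ⟨⟨a, m⟩, hx⟩ := IsLocalization.surj (Submonoid.powers g) x
  simp only at hx
  have hu : IsUnit (algebraMap R (Localization.Away h) (m : R)) := by
    have := (IsLocalization.map_units (Localization.Away g) m).map (awayMap (K := K) hgh)
    rwa [awayMap_algebraMap] at this
  have h1 := congrArg (fun y => awayMap (K := K) hgh (awayDerivation D g y)) hx
  have h2 := congrArg (fun y => awayDerivation D h (awayMap (K := K) hgh y)) hx
  simp only [Derivation.leibniz, map_add, map_mul, smul_eq_mul, awayDerivation_algebraMap,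
    awayMap_algebraMap] at h1 h2
  apply hu.mul_left_cancel
  linear_combination h1 - h2

end Localization

/-! ### Local cohomology as Čech cohomology -/

section Cech

variable {K R : Type u} [Field K] [CommRing R] [Algebra K R] {s : ℕ}

/-- The localization `R_{f_S}`, where `f_S = ∏_{i ∈ S} f_i`. -/
abbrev CechPiece (f : Fin s → R) (S : Finset (Fin s)) : Type u :=
  Localization.Away (∏ i ∈ S, f i)

theorem prod_erase_dvd (f : Fin s → R) (T : Finset (Fin s)) (i : Fin s) :
    ∏ j ∈ T.erase i, f j ∣ ∏ j ∈ T, f j :=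
  Finset.prod_dvd_prod_of_subset _ _ _ (Finset.erase_subset _ _)

/-- The differential of the Čech complex
`0 → R → ∏_i R_{f_i} → ∏_{i < j} R_{f_i f_j} → ⋯ → R_{f_1 ⋯ f_s} → 0`. -/
def cechDiff (K : Type u) [Field K] [Algebra K R] (f : Fin s → R) (p : ℕ) :
    (∀ S : Subsets s p, CechPiece f S.1) →ₗ[K] (∀ T : Subsets s (p + 1), CechPiece f T.1) :=
  altDiff (CechPiece f) (fun T i => (awayMap (K := K) (prod_erase_dvd f T i.1)).toLinearMap) p

/-- The local cohomology `H^p_I(R)` (as a `K`-vector space) of the ideal `I = (f_1, …, f_s)` of the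
Noetherian ring `R`, computed by the Čech complex on the generators `f_1, …, f_s`. -/
abbrev LocalCohomology (K : Type u) [Field K] [Algebra K R] (f : Fin s → R) (p : ℕ) : Type u :=
  Cohomology (C := fun p => ∀ S : Subsets s p, CechPiece f S.1) (cechDiff K f) p

/-- The componentwise action of a derivation of `R` on the Čech complex. -/
def cechDerivation (D : Derivation K R R) (f : Fin s → R) (p : ℕ) :
    (∀ S : Subsets s p, CechPiece f S.1) →ₗ[K] (∀ S : Subsets s p, CechPiece f S.1) :=
  LinearMap.pi fun S => (awayDerivation D (∏ i ∈ S.1, f i)).toLinearMap ∘ₗ LinearMap.proj S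

theorem cechDiff_cechDerivation (D : Derivation K R R) (f : Fin s → R) (p : ℕ)
    (c : ∀ S : Subsets s p, CechPiece f S.1) :
    cechDiff K f p (cechDerivation D f p c) = cechDerivation D f (p + 1) (cechDiff K f p c) := by
  funext T
  change (∑ i : {i // i ∈ T.1}, _ • _) = awayDerivation D _ (∑ i : {i // i ∈ T.1}, _ • _)
  rw [map_sum]
  refine Finset.sum_congr rfl fun i _ => ?_
  rw [Derivation.map_smul]
  refine congrArg _ ?_
  exact awayMap_awayDerivation D (prod_erase_dvd f T.1 i.1) (c (T.erase i))

/-- The action of a derivation of `R` on local cohomology. -/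
def lcDerivation (D : Derivation K R R) (f : Fin s → R) (p : ℕ) :
    LocalCohomology K f p →ₗ[K] LocalCohomology K f p :=
  Cohomology.map _ (cechDerivation D f) (cechDiff_cechDerivation D f) p

end Cech

/-- The action of `∂_i = ∂/∂X_i` on the local cohomology of `R = K[X_1, …, X_n]` with respect to the
ideal generated by `f_1, …, f_s`. -/
def lcPartial {K : Type u} [Field K] {n s : ℕ} (f : Fin s → MvPolynomial (Fin n) K) (p : ℕ)
    (i : Fin n) : LocalCohomology K f p →ₗ[K] LocalCohomology K f p :=
  lcDerivation (MvPolynomial.pderiv i) f p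

/-- An ideal `I` is zero-dimensional if the length of `R / I` is finite and non-zero. -/
def IsZeroDimensional {R : Type u} [CommRing R] (I : Ideal R) : Prop :=
  Module.length R (R ⧸ I) ≠ ⊤ ∧ Module.length R (R ⧸ I) ≠ 0

end DeRhamLC

end

/-!
Modulo the radical of `I` each variable `X_i` satisfies a separable equation `g_i(X_i) = 0`. Every
element of `N = H^n_I(R)` is killed by a power of `g_i(X_i)`, and since `[∂_i, p(X_i)] = p'(X_i)`,
separability and characteristic zero give `N = ⋂_{i ∈ U} ker g_i(X_i) ⊕ ∑_{i ∈ U} ∂_i N` for every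
set `U` of indices. Hence `∂_1, …, ∂_n` is a weakly regular sequence of operators on `N`, so that
the de Rham complex, being a Koszul complex, is exact below degree `n`; and
`H^n(∂; N) ≅ ⋂_i ker g_i(X_i)`.

The `g_i(X_i)` also form a regular sequence of `R` inside the radical of `I`. Composing the
connecting maps of the successive quotients identifies their common kernel on `H^n_I(R)` with
`Γ_I(R / J)`, where `J = (g_1(X_1), …, g_n(X_n))`. The ring `R / J` is étale over `K`, hence a
finite product of fields, so `Γ_I(R / J) ≅ R / (J + I)`: a finite reduced algebra whose dimension
counts its `L`-points, which are the points of `V(I)_L`.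
-/

noncomputable section

namespace DeRhamLC

/-! ### Koszul complexes of commuting operators -/

section Endomorphisms

variable {R N ι : Type*} [CommRing R] [AddCommGroup N] [Module R N]

/-- The submodule `∑_{i ∈ U} D_i N`. -/
def rangeSum (D : ι → Module.End R N) (U : Finset ι) : Submodule R N :=
  ⨆ i ∈ U, LinearMap.range (D i)

/-- The submodule `⋂_{i ∈ U} ker A_i`. -/
def commonKer (A : ι → Module.End R N) (U : Finset ι) : Submodule R N :=
  ⨅ i ∈ U, LinearMap.ker (A i)

variable {D : ι → Module.End R N} {U : Finset ι}

theorem apply_mem_rangeSum {i : ι} (hi : i ∈ U) (x : N) : D i x ∈ rangeSum D U :=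
  Submodule.mem_iSup_of_mem i (Submodule.mem_iSup_of_mem hi (LinearMap.mem_range_self _ _))

theorem mem_commonKer {v : N} : v ∈ commonKer D U ↔ ∀ i ∈ U, D i v = 0 := by
  simp [commonKer]

variable {φ : Module.End R N} {v : N}

theorem map_mem_rangeSum (hφ : ∀ i, Commute φ (D i)) (hv : v ∈ rangeSum D U) :
    φ v ∈ rangeSum D U := by
  suffices h : rangeSum D U ≤ (rangeSum D U).comap φ from h hv
  refine iSup₂_le fun i hi => ?_
  rintro _ ⟨y, rfl⟩
  rw [Submodule.mem_comap, ← Module.End.mul_apply, (hφ i).eq]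
  exact apply_mem_rangeSum hi (φ y)

theorem map_mem_commonKer (hφ : ∀ i ∈ U, Commute φ (D i)) (hv : v ∈ commonKer D U) :
    φ v ∈ commonKer D U := by
  rw [mem_commonKer] at hv ⊢
  intro i hi
  rw [← Module.End.mul_apply, ← (hφ i hi).eq, Module.End.mul_apply, hv i hi, map_zero]

end Endomorphisms

section Koszul

variable {R N ι : Type*} [CommRing R] [AddCommGroup N] [Module R N] [LinearOrder ι]

/-- The differential of the Koszul cochain complex of the operators `D i`, on cochains of all
degrees at once: the component `ω S` of a cochain is the coefficient of `⋀_{i ∈ S} e_i`. -/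
def koszulDiff (D : ι → Module.End R N) : Module.End R (Finset ι → N) :=
  LinearMap.pi fun T => ∑ i ∈ T, (-1 : ℤ) ^ (T.filter (· < i)).card • D i ∘ₗ
    LinearMap.proj (T.erase i)

/-- The operators `D i`, `i ∈ U`, in increasing order, form a regular sequence on `N`, except that
`N = ∑_{i ∈ U} D_i N` is allowed. -/
def IsWeaklyRegularOn (D : ι → Module.End R N) (U : Finset ι) : Prop :=
  ∀ i ∈ U, ∀ x, D i x ∈ rangeSum D (U.filter (· < i)) → x ∈ rangeSum D (U.filter (· < i))

/-- Exactness in degree `p` of the Koszul complex of the operators `D i`, `i ∈ U`. -/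
def KoszulExactAt (D : ι → Module.End R N) (U : Finset ι) (p : ℕ) : Prop :=
  ∀ ω : Finset ι → N, (∀ T ⊆ U, T.card = p + 1 → koszulDiff D ω T = 0) →
    ∃ γ : Finset ι → N, ∀ S ⊆ U, S.card = p → koszulDiff D γ S = ω S

variable {D : ι → Module.End R N}

theorem koszulDiff_apply (ω : Finset ι → N) (T : Finset ι) :
    koszulDiff D ω T = ∑ i ∈ T, (-1 : ℤ) ^ (T.filter (· < i)).card • D i (ω (T.erase i)) := by
  simp [koszulDiff]

theorem koszulDiff_congr {ω η : Finset ι → N} {T : Finset ι}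
    (h : ∀ i ∈ T, ω (T.erase i) = η (T.erase i)) : koszulDiff D ω T = koszulDiff D η T := by
  simp only [koszulDiff_apply]
  exact Finset.sum_congr rfl fun i hi => by rw [h i hi]

theorem koszulDiff_comp {A : Module.End R N} (hA : ∀ i, Commute (D i) A) (ω : Finset ι → N) :
    koszulDiff D (A ∘ ω) = A ∘ koszulDiff D ω := by
  funext T
  have hDA (i : ι) (x : N) : D i (A x) = A (D i x) := LinearMap.congr_fun (hA i) x
  simp [koszulDiff_apply, hDA]

theorem koszulDiff_insert_max {S : Finset ι} {i : ι} (hi : ∀ j ∈ S, j < i) (ω : Finset ι → N) :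
    koszulDiff D ω (insert i S) =
      koszulDiff D (fun S' => ω (insert i S')) S + (-1 : ℤ) ^ S.card • D i (ω S) := by
  have hiS : i ∉ S := fun h => lt_irrefl _ (hi i h)
  rw [koszulDiff_apply, koszulDiff_apply, Finset.sum_insert hiS, add_comm]
  congr 1
  · refine Finset.sum_congr rfl fun j hj => ?_
    rw [Finset.erase_insert_of_ne (hi j hj).ne', Finset.filter_insert,
      if_neg (hi j hj).le.not_gt]
  · rw [Finset.erase_insert hiS, Finset.filter_insert, if_neg (lt_irrefl i),
      Finset.filter_true_of_mem hi]

theorem koszulDiff_koszulDiff (hD : ∀ i j, Commute (D i) (D j)) (ω : Finset ι → N)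
    (T : Finset ι) : koszulDiff D (koszulDiff D ω) T = 0 := by
  induction T using Finset.induction_on_max generalizing ω with
  | empty => simp [koszulDiff_apply]
  | insert i S hi ih =>
    have expand : koszulDiff D (fun S' => koszulDiff D ω (insert i S')) S =
        koszulDiff D (koszulDiff D (fun S' => ω (insert i S')) -
          (-1 : ℤ) ^ S.card • (D i ∘ ω)) S := by
      refine koszulDiff_congr fun j hj => ?_
      rw [koszulDiff_insert_max fun k hk => hi k (Finset.mem_of_mem_erase hk),
        ← Finset.card_erase_add_one hj, pow_succ]
      simp
    rw [koszulDiff_insert_max hi, expand, map_sub, map_zsmul, koszulDiff_comp fun j => hD j i]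
    simp [ih]

theorem koszulDiff_mem_rangeSum (ω : Finset ι → N) (T : Finset ι) :
    koszulDiff D ω T ∈ rangeSum D T := by
  rw [koszulDiff_apply]
  exact sum_mem fun i hi => zsmul_mem (apply_mem_rangeSum hi _) _

theorem exists_koszulDiff_eq {T : Finset ι} {x : N} (hx : x ∈ rangeSum D T) :
    ∃ ω : Finset ι → N, koszulDiff D ω T = x := by
  suffices h : rangeSum D T ≤ LinearMap.range (LinearMap.proj T ∘ₗ koszulDiff D) from h hx
  refine iSup₂_le fun i hi => ?_
  rintro _ ⟨y, rfl⟩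
  refine ⟨Pi.single (T.erase i) ((-1 : ℤ) ^ (T.filter (· < i)).card • y), ?_⟩
  rw [LinearMap.comp_apply, LinearMap.proj_apply, koszulDiff_apply,
    Finset.sum_eq_single_of_mem i hi]
  · simp [smul_smul, ← mul_pow]
  · intro j hj hji
    have herase : T.erase j ≠ T.erase i := fun h => hji (Finset.erase_injOn T hj hi h)
    rw [Pi.single_eq_of_ne herase, map_zero, smul_zero]

theorem IsWeaklyRegularOn.of_insert_max {U : Finset ι} {i : ι} (hi : ∀ j ∈ U, j < i)
    (h : IsWeaklyRegularOn D (insert i U)) : IsWeaklyRegularOn D U := by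
  intro j hj
  have := h j (Finset.mem_insert_of_mem hj)
  rwa [Finset.filter_insert, if_neg (hi j hj).le.not_gt] at this

theorem IsWeaklyRegularOn.mem_of_insert_max {U : Finset ι} {i : ι} (hi : ∀ j ∈ U, j < i)
    (h : IsWeaklyRegularOn D (insert i U)) {x : N} (hx : D i x ∈ rangeSum D U) :
    x ∈ rangeSum D U := by
  have := h i (Finset.mem_insert_self i U) x
  rw [Finset.filter_insert, if_neg (lt_irrefl i), Finset.filter_true_of_mem hi] at this
  exact this hx

theorem exists_koszulDiff_eq_of_insert_max {U : Finset ι} {i : ι} (hi : ∀ j ∈ U, j < i)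
    (h : IsWeaklyRegularOn D (insert i U)) {ω : Finset ι → N}
    (hω : koszulDiff D ω (insert i U) = 0) : ∃ γ : Finset ι → N, koszulDiff D γ U = ω U := by
  refine exists_koszulDiff_eq (h.mem_of_insert_max hi ?_)
  rw [koszulDiff_insert_max hi] at hω
  have hmem : (-1 : ℤ) ^ U.card • D i (ω U) ∈ rangeSum D U := by
    rw [eq_neg_of_add_eq_zero_right hω]
    exact neg_mem (koszulDiff_mem_rangeSum _ _)
  simpa [smul_smul, ← mul_pow] using zsmul_mem hmem ((-1) ^ U.card)

-- Let `β` solve the equation for the coefficients of `e_i`, corrected by `∓ D_i γ`.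
theorem KoszulExactAt.exists_extend_insert_max (hD : ∀ i j, Commute (D i) (D j)) {U : Finset ι}
    {i : ι} (hi : ∀ j ∈ U, j < i) {p : ℕ} (hU : KoszulExactAt D U p) {ω γ : Finset ι → N}
    (hω : ∀ T ⊆ insert i U, T.card = p + 2 → koszulDiff D ω T = 0)
    (hγ : ∀ S ⊆ U, S.card = p + 1 → koszulDiff D γ S = ω S) :
    ∃ γ' : Finset ι → N, ∀ S ⊆ insert i U, S.card = p + 1 → koszulDiff D γ' S = ω S := by
  have hiU : i ∉ U := fun h => lt_irrefl _ (hi i h)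
  obtain ⟨β, hβ⟩ := hU ((fun S => ω (insert i S)) - (-1 : ℤ) ^ p • (D i ∘ γ)) fun T hT hTp => by
    have hωT := hω (insert i T) (Finset.insert_subset_insert i hT)
      (by rw [Finset.card_insert_of_notMem fun h => hiU (hT h), hTp])
    rw [koszulDiff_insert_max fun j hj => hi j (hT hj), hTp, pow_succ] at hωT
    rw [map_sub, map_zsmul, koszulDiff_comp fun j => hD j i]
    simpa [hγ T hT hTp, sub_eq_add_neg] using hωT
  refine ⟨fun S => if i ∈ S then β (S.erase i) else γ S, fun S hS hSp => ?_⟩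
  by_cases hiS : i ∈ S
  · obtain ⟨S', hiS', rfl⟩ : ∃ S', i ∉ S' ∧ insert i S' = S :=
      ⟨S.erase i, Finset.notMem_erase i S, Finset.insert_erase hiS⟩
    have hS'U : S' ⊆ U := (Finset.insert_subset_insert_iff hiS').1 hS
    have hS'p : S'.card = p := by simpa [Finset.card_insert_of_notMem hiS'] using hSp
    rw [koszulDiff_insert_max (fun j hj => hi j (hS'U hj)), if_neg hiS', hS'p,
      koszulDiff_congr (η := β) fun j _ => ?_, hβ S' hS'U hS'p]
    · simp
    · rw [if_pos (Finset.mem_insert_self _ _),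
        Finset.erase_insert fun h => hiS' (Finset.mem_of_mem_erase h)]
  · rw [koszulDiff_congr (η := γ) fun j _ => if_neg fun h => hiS (Finset.mem_of_mem_erase h)]
    exact hγ S ((Finset.subset_insert_iff_of_notMem hiS).1 hS) hSp

theorem IsWeaklyRegularOn.koszulExactAt (hD : ∀ i j, Commute (D i) (D j)) {U : Finset ι}
    (h : IsWeaklyRegularOn D U) {p : ℕ} (hp : p < U.card) : KoszulExactAt D U p := by
  induction U using Finset.induction_on_max generalizing p with
  | empty => simp at hp
  | insert i U hi ih =>
    have ih' {q : ℕ} : q < U.card → KoszulExactAt D U q := ih (h.of_insert_max hi)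
    have hcard : (insert i U).card = U.card + 1 :=
      Finset.card_insert_of_notMem fun h => lt_irrefl _ (hi i h)
    intro ω hω
    obtain ⟨γ, hγ⟩ : ∃ γ : Finset ι → N, ∀ S ⊆ U, S.card = p → koszulDiff D γ S = ω S := by
      rcases (Nat.lt_succ_iff.1 (hcard ▸ hp)).lt_or_eq with hpU | rfl
      · exact ih' hpU ω fun T hT => hω T (hT.trans (Finset.subset_insert i U))
      · obtain ⟨γ, hγ⟩ := exists_koszulDiff_eq_of_insert_max hi h (hω _ subset_rfl hcard)
        exact ⟨γ, fun S hS hSU => by rwa [Finset.eq_of_subset_of_card_le hS hSU.ge]⟩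
    cases p with
    | zero =>
      refine ⟨γ, fun S _ hS => ?_⟩
      obtain rfl := Finset.card_eq_zero.1 hS
      exact hγ ∅ (Finset.empty_subset U) rfl
    | succ p => exact (ih' (by omega)).exists_extend_insert_max hD hi hω hγ

end Koszul

/-! ### Modules over the Weyl algebra -/

section Weyl

open Polynomial

theorem mul_aeval_of_commutator_eq_one {R A : Type*} [CommRing R] [Ring A] [Algebra R A] {x d : A}
    (h : d * x - x * d = 1) (p : R[X]) :
    d * aeval x p = aeval x p * d + aeval x (derivative p) := by
  have hdx : d * x = x * d + 1 := sub_eq_iff_eq_add'.1 h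
  induction p using Polynomial.induction_on with
  | C a => simp [Algebra.commutes a d]
  | add p q hp hq =>
    simp only [map_add, mul_add, add_mul, hp, hq]
    abel
  | monomial k a ih =>
    rw [pow_succ, ← mul_assoc]
    generalize C a * X ^ k = q at ih ⊢
    rw [derivative_mul, derivative_X, map_add, map_mul, map_mul, aeval_X, mul_one, ← mul_assoc, ih,
      add_mul, mul_assoc _ d, hdx]
    noncomm_ring

theorem commute_aeval {R A : Type*} [CommRing R] [Ring A] [Algebra R A] {a x : A}
    (h : Commute a x) (p : R[X]) : Commute a (aeval x p) :=
  Algebra.commute_of_mem_adjoin_singleton_of_commute (aeval_mem_adjoin_singleton R x) h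

theorem isCompl_inf_sup_range {R N : Type*} [Ring R] [AddCommGroup N] [Module R N]
    {W S E : Submodule R N} {d : Module.End R N} (hWS : IsCompl W S) (hW : ∀ w ∈ W, d w ∈ W)
    (hS : ∀ v ∈ S, d v ∈ S) (hWE : W ≤ W ⊓ E ⊔ W.map d) (hE : Disjoint E (LinearMap.range d)) :
    IsCompl (W ⊓ E) (LinearMap.range d ⊔ S) := by
  refine ⟨Submodule.disjoint_def.2 fun w hw hwd => ?_, codisjoint_iff_le_sup.2 ?_⟩
  · obtain ⟨_, ⟨y, rfl⟩, s, hs, rfl⟩ := Submodule.mem_sup.1 hwd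
    obtain ⟨w', hw', t, ht, rfl⟩ :=
      Submodule.mem_sup.1 (hWS.sup_eq_top.ge (Submodule.mem_top (x := y)))
    have hdts : d t + s = 0 := Submodule.disjoint_def.1 hWS.disjoint _
      (by simpa [add_assoc] using sub_mem hw.1 (hW w' hw')) (add_mem (hS t ht) hs)
    rw [map_add, add_assoc, hdts, add_zero] at hw ⊢
    exact Submodule.disjoint_def.1 hE _ hw.2 ⟨w', rfl⟩
  · calc (⊤ : Submodule R N) ≤ W ⊔ S := hWS.sup_eq_top.ge
      _ ≤ W ⊓ E ⊔ LinearMap.range d ⊔ S :=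
        sup_le_sup_right (hWE.trans (sup_le_sup_left LinearMap.map_le_range _)) S
      _ = W ⊓ E ⊔ (LinearMap.range d ⊔ S) := sup_assoc _ _ _

section OneVariable

variable {K N : Type*} [Field K] [CharZero K] [AddCommGroup N] [Module K N]
  {x d : Module.End K N} (h : d * x - x * d = 1) {g : K[X]}

include h

-- The correction works because `[d, g ^ (k + 1)] = (k + 1) * g ^ k * derivative g` and
-- `b * derivative g ≡ 1` modulo `g`.
theorem aeval_pow_apply_add_eq_zero {a b : K[X]} (hab : a * g + b * derivative g = 1) {k : ℕ}
    {u : N} (hu : aeval x (g ^ (k + 2)) u = 0) :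
    aeval x (g ^ (k + 1)) (u + d (aeval x (C (k + 1 : K)⁻¹ * (g * b)) u)) = 0 := by
  have hk : (k + 1 : K) ≠ 0 := k.cast_add_one_ne_zero
  set q : K[X] := C (k + 1 : K)⁻¹ * (g * b) with hq
  have hcomm : aeval x (g ^ (k + 1)) (d (aeval x q u)) =
      d (aeval x (g ^ (k + 1) * q) u) - aeval x (derivative (g ^ (k + 1)) * q) u := by
    rw [map_mul _ _ q, map_mul _ _ q, eq_sub_iff_add_eq]
    exact (LinearMap.congr_fun (mul_aeval_of_commutator_eq_one h (g ^ (k + 1))) (aeval x q u)).symm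
  have hgq : g ^ (k + 1) * q = (C (k + 1 : K)⁻¹ * b) * g ^ (k + 2) := by rw [hq]; ring
  have hg'q : derivative (g ^ (k + 1)) * q = g ^ (k + 1) - a * g ^ (k + 2) := by
    have hC : C (k + 1 : K)⁻¹ * C (k + 1 : K) = 1 := by rw [← C_mul, inv_mul_cancel₀ hk, C_1]
    rw [hq, derivative_pow_succ]
    linear_combination g ^ (k + 1) * hab + g ^ (k + 1) * b * derivative g * hC
  have hmul (p : K[X]) : aeval x (p * g ^ (k + 2)) u = 0 := by
    rw [map_mul, Module.End.mul_apply, hu, map_zero]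
  rw [map_add, hcomm, hgq, hg'q, map_sub, LinearMap.sub_apply, hmul, hmul, map_zero]
  abel

variable (hg : g.Separable)

include hg

-- Apply `[d, g ^ (k + 1)] = (k + 1) g ^ k g'` to `v`, and use that `g'` is invertible modulo `g`.
theorem aeval_pow_apply_eq_zero {k : ℕ} {v : N} (hv : aeval x (g ^ (k + 1)) v = 0)
    (hdv : aeval x (g ^ (k + 1)) (d v) = 0) : aeval x (g ^ k) v = 0 := by
  obtain ⟨a, b, hab⟩ := hg
  have hderiv : aeval x (derivative (g ^ (k + 1))) v = 0 := by
    have hcomm := LinearMap.congr_fun (mul_aeval_of_commutator_eq_one h (g ^ (k + 1))) v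
    simp only [Module.End.mul_apply, LinearMap.add_apply, hv, hdv, map_zero, zero_add] at hcomm
    exact hcomm.symm
  have hk : (k + 1 : K) ≠ 0 := k.cast_add_one_ne_zero
  have hgk : g ^ k = a * g ^ (k + 1) + (C (k + 1 : K)⁻¹ * b) * derivative (g ^ (k + 1)) := by
    have hC : C (k + 1 : K)⁻¹ * C (k + 1 : K) = 1 := by rw [← C_mul, inv_mul_cancel₀ hk, C_1]
    rw [derivative_pow_succ]
    linear_combination (-g ^ k) * hab - b * g ^ k * derivative g * hC
  rw [hgk, map_add, map_mul, map_mul, LinearMap.add_apply, Module.End.mul_apply,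
    Module.End.mul_apply, hv, hderiv, map_zero, map_zero, add_zero]

theorem eq_zero_of_aeval_apply_eq_zero (htors : ∀ v : N, ∃ k, aeval x (g ^ k) v = 0) {v : N}
    (hv : aeval x g (d v) = 0) : v = 0 := by
  obtain ⟨k, hk⟩ := htors v
  induction k with
  | zero => simpa using hk
  | succ k ih =>
    refine ih (aeval_pow_apply_eq_zero h hg hk ?_)
    rw [pow_succ, map_mul, Module.End.mul_apply, hv, map_zero]

theorem disjoint_ker_aeval_range (htors : ∀ v : N, ∃ k, aeval x (g ^ k) v = 0) :
    Disjoint (LinearMap.ker (aeval x g)) (LinearMap.range d) := by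
  refine Submodule.disjoint_def.2 ?_
  rintro _ hv ⟨v, rfl⟩
  rw [eq_zero_of_aeval_apply_eq_zero h hg htors hv, map_zero]

theorem le_inf_ker_aeval_sup_map (htors : ∀ v : N, ∃ k, aeval x (g ^ k) v = 0)
    {W : Submodule K N} (hWx : ∀ w ∈ W, x w ∈ W) (hWd : ∀ w ∈ W, d w ∈ W) :
    W ≤ W ⊓ LinearMap.ker (aeval x g) ⊔ W.map d := by
  obtain ⟨a, b, hab⟩ := hg
  intro u hu
  obtain ⟨k, hk⟩ : ∃ k, aeval x (g ^ (k + 1)) u = 0 := by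
    obtain ⟨k, hk⟩ := htors u
    exact ⟨k, by rw [pow_succ', map_mul, Module.End.mul_apply, hk, map_zero]⟩
  induction k generalizing u with
  | zero => exact Submodule.mem_sup_left ⟨hu, by simpa using hk⟩
  | succ k ih =>
    have hW : aeval x (C (k + 1 : K)⁻¹ * (g * b)) u ∈ W :=
      aeval_apply_smul_mem_of_le_comap hu _ _ hWx
    have hu' := ih (W.add_mem hu (hWd _ hW)) (aeval_pow_apply_add_eq_zero h hab hk)
    simpa using Submodule.sub_mem _ hu' (Submodule.mem_sup_right (Submodule.mem_map_of_mem hW))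

end OneVariable

variable {N ι : Type*} [AddCommGroup N]

/-- The defining relations of the Weyl algebra: the `x i` act as multiplication by coordinates and
the `d i` as the corresponding partial derivatives. -/
structure WeylRelations {R : Type*} [CommRing R] [Module R N] (x d : ι → Module.End R N) :
    Prop where
  commute_x : ∀ i j, Commute (x i) (x j)
  commute_d : ∀ i j, Commute (d i) (d j)
  commute_d_x : ∀ i j, i ≠ j → Commute (d i) (x j)
  commutator_d_x : ∀ i, d i * x i - x i * d i = 1

namespace WeylRelations

theorem d_mem_commonKer {R : Type*} [CommRing R] [Module R N] {x d : ι → Module.End R N}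
    (h : WeylRelations x d) {g : ι → R[X]} {U : Finset ι} {i : ι} (hi : i ∉ U) {v : N}
    (hv : v ∈ commonKer (fun i => aeval (x i) (g i)) U) :
    d i v ∈ commonKer (fun i => aeval (x i) (g i)) U :=
  map_mem_commonKer (fun j hj => commute_aeval
    (h.commute_d_x i j fun hij => hi (hij ▸ hj)) _) hv

variable {K : Type*} [Field K] [CharZero K] [Module K N] {x d : ι → Module.End K N}
  (h : WeylRelations x d) {g : ι → K[X]} (hg : ∀ i, (g i).Separable)
  (htors : ∀ i (v : N), ∃ k, aeval (x i) (g i ^ k) v = 0)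

include h hg htors

theorem isCompl_commonKer_rangeSum (U : Finset ι) :
    IsCompl (commonKer (fun i => aeval (x i) (g i)) U) (rangeSum d U) := by
  classical
  induction U using Finset.induction_on with
  | empty => simpa [commonKer, rangeSum] using isCompl_top_bot
  | insert i U hi ih =>
    rw [commonKer, Finset.iInf_insert, inf_comm, rangeSum, Finset.iSup_insert]
    have hx : ∀ w ∈ commonKer (fun i => aeval (x i) (g i)) U, x i w ∈ _ := fun w hw =>
      map_mem_commonKer (fun j _ => commute_aeval (h.commute_x i j) _) hw
    have hd : ∀ w ∈ commonKer (fun i => aeval (x i) (g i)) U, d i w ∈ _ := fun w hw =>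
      h.d_mem_commonKer hi hw
    exact isCompl_inf_sup_range ih hd (fun v hv => map_mem_rangeSum (h.commute_d i) hv)
      (le_inf_ker_aeval_sup_map (h.commutator_d_x i) (hg i) (htors i) hx hd)
      (disjoint_ker_aeval_range (h.commutator_d_x i) (hg i) (htors i))

theorem isWeaklyRegularOn [LinearOrder ι] (U : Finset ι) : IsWeaklyRegularOn d U := by
  intro i _ v hv
  set V := U.filter (· < i)
  have hiV : i ∉ V := by simp [V]
  have hcompl := h.isCompl_commonKer_rangeSum hg htors V
  obtain ⟨w, hw, r, hr, rfl⟩ :=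
    Submodule.mem_sup.1 (hcompl.sup_eq_top.ge (Submodule.mem_top (x := v)))
  have hdw : d i w ∈ rangeSum d V := by
    simpa using sub_mem hv (map_mem_rangeSum (h.commute_d i) hr)
  have hdw0 : d i w = 0 :=
    Submodule.disjoint_def.1 hcompl.disjoint _ (h.d_mem_commonKer hiV hw) hdw
  have hw0 : w = 0 := eq_zero_of_aeval_apply_eq_zero (h.commutator_d_x i) (hg i) (htors i)
    (by rw [hdw0, map_zero])
  rwa [hw0, zero_add]

end WeylRelations

end Weyl

/-! ### De Rham cohomology -/

section DeRham

theorem sgn_smul (K : Type u) [Field K] {M : Type*} [AddCommGroup M] [Module K M] {s : ℕ}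
    (T : Finset (Fin s)) (i : Fin s) (x : M) :
    sgn K T i • x = (-1 : ℤ) ^ (T.filter (· < i)).card • x := by
  rw [sgn, ← Int.cast_smul_eq_zsmul K]
  simp

variable {K : Type u} [Field K] {N : Type u} [AddCommGroup N] [Module K N] {n : ℕ}
  {del : Fin n → Module.End K N}

theorem deRhamDiff_restrict {p : ℕ} (ω : Finset (Fin n) → N) (T : Subsets n (p + 1)) :
    deRhamDiff del p (fun S => ω S.1) T = koszulDiff del ω T.1 := by
  rw [koszulDiff_apply, ← Finset.sum_coe_sort]
  exact Finset.sum_congr rfl fun i _ => sgn_smul K _ _ _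

theorem mem_coboundaries_deRhamDiff {p : ℕ} {c : Subsets n p → N} :
    c ∈ coboundaries (C := fun p => Subsets n p → N) (deRhamDiff del) p ↔
      ∃ γ : Finset (Fin n) → N, ∀ S : Subsets n p, koszulDiff del γ S.1 = c S := by
  cases p with
  | zero =>
    have hzero (γ : Finset (Fin n) → N) (S : Subsets n 0) : koszulDiff del γ S.1 = 0 := by
      rw [Finset.card_eq_zero.1 S.2]
      simp [koszulDiff_apply]
    simp only [hzero, exists_const]
    exact (Submodule.mem_bot K).trans (funext_iff.trans (forall_congr' fun S => eq_comm))
  | succ p =>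
    constructor
    · rintro ⟨b, rfl⟩
      obtain ⟨γ, rfl⟩ := Subtype.exists_pi_extension (α := fun _ => N) b
      exact ⟨γ, fun S => (deRhamDiff_restrict γ S).symm⟩
    · rintro ⟨γ, hγ⟩
      exact ⟨fun S => γ S.1, funext fun S => (deRhamDiff_restrict γ S).trans (hγ S)⟩

theorem subsingleton_deRhamCohomology (hcomm : ∀ i j, Commute (del i) (del j))
    (hreg : IsWeaklyRegularOn del Finset.univ) {p : ℕ} (hp : p < n) :
    Subsingleton (DeRhamCohomology del p) := by
  rw [Submodule.Quotient.subsingleton_iff, Submodule.submoduleOf_eq_top]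
  intro c hc
  obtain ⟨ω, rfl⟩ := Subtype.exists_pi_extension (α := fun _ => N) c
  obtain ⟨γ, hγ⟩ := hreg.koszulExactAt hcomm (by simpa using hp) ω fun T _ hT => by
    rw [← deRhamDiff_restrict ω ⟨T, hT⟩, LinearMap.mem_ker.1 hc, Pi.zero_apply]
  exact mem_coboundaries_deRhamDiff.2 ⟨γ, fun S => hγ S.1 (Finset.subset_univ _) S.2⟩

instance : Unique (Subsets n n) where
  default := ⟨Finset.univ, Finset.card_fin n⟩
  uniq S := Subtype.ext ((Finset.card_eq_iff_eq_univ _).1 (by rw [S.2, Fintype.card_fin]))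

theorem isEmpty_subsets_succ : IsEmpty (Subsets n (n + 1)) :=
  ⟨fun S => by simpa [S.2] using S.1.card_le_univ⟩

theorem ker_deRhamDiff_top : LinearMap.ker (deRhamDiff del n) = ⊤ :=
  have := isEmpty_subsets_succ (n := n)
  LinearMap.ker_eq_top.2 (LinearMap.ext fun _ => Subsingleton.elim _ _)

theorem mem_coboundaries_deRhamDiff_top {c : Subsets n n → N} :
    c ∈ coboundaries (C := fun p => Subsets n p → N) (deRhamDiff del) n ↔
      c default ∈ rangeSum del Finset.univ := by
  refine mem_coboundaries_deRhamDiff.trans ⟨?_, fun hc => ?_⟩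
  · rintro ⟨γ, hγ⟩
    exact hγ default ▸ koszulDiff_mem_rangeSum γ Finset.univ
  · obtain ⟨γ, hγ⟩ := exists_koszulDiff_eq hc
    exact ⟨γ, fun S => Unique.eq_default S ▸ hγ⟩

/-- The top de Rham cohomology of `N` is `N / ∑_i ∂_i N`. -/
def deRhamCohomologyTopEquiv (del : Fin n → Module.End K N) :
    DeRhamCohomology del n ≃ₗ[K] N ⧸ rangeSum del Finset.univ :=
  Submodule.Quotient.equiv _ _
    (LinearEquiv.ofTop _ ker_deRhamDiff_top ≪≫ₗ LinearEquiv.funUnique (Subsets n n) K N) (by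
      ext v
      rw [Submodule.mem_map_equiv]
      exact mem_coboundaries_deRhamDiff_top)

end DeRham

/-! ### Čech cochains with coefficients in a module -/

section CechCochains

variable {R : Type*} [CommRing R] {s : ℕ} (f : Fin s → R)

/-- The powers of `f_S = ∏_{i ∈ S} f_i`. -/
abbrev prodPowers (S : Finset (Fin s)) : Submonoid R := Submonoid.powers (∏ i ∈ S, f i)

variable {M : Type*} [AddCommGroup M] [Module R M] {A : Finset (Fin s) → Type*}
  [∀ S, AddCommGroup (A S)] [∀ S, Module R (A S)] (loc : ∀ S, M →ₗ[R] A S)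
  [hloc : ∀ S, IsLocalizedModule (prodPowers f S) (loc S)] {S T : Finset (Fin s)}

include loc hloc in
theorem isUnit_algebraMap_prodPowers (h : S ⊆ T) (x : prodPowers f S) :
    IsUnit (algebraMap R (Module.End R (A T)) x) := by
  obtain ⟨_, k, rfl⟩ := x
  have hunit := IsLocalizedModule.map_units (S := prodPowers f T) (loc T) ⟨_, k, rfl⟩
  obtain ⟨c, hc⟩ := pow_dvd_pow_of_dvd (Finset.prod_dvd_prod_of_subset S T f h) k
  simp only [hc, map_mul] at hunit
  exact ((Algebra.commute_algebraMap_left _ _).isUnit_mul_iff.1 hunit).1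

include loc hloc in
theorem prod_pow_smul_bijective (h : S ⊆ T) (k : ℕ) :
    Function.Bijective fun x : A T => (∏ i ∈ S, f i) ^ k • x :=
  (Module.End.isUnit_iff _).1 (isUnit_algebraMap_prodPowers f loc h ⟨_, k, rfl⟩)

/-- The canonical map `M_{f_S} → M_{f_T}` for `S ⊆ T`. -/
def locRes (h : S ⊆ T) : A S →ₗ[R] A T :=
  IsLocalizedModule.lift (prodPowers f S) (loc S) (loc T) (isUnit_algebraMap_prodPowers f loc h)

@[simp]
theorem locRes_loc (h : S ⊆ T) (m : M) : locRes f loc h (loc S m) = loc T m :=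
  IsLocalizedModule.lift_apply _ _ _ _ _

theorem locRes_unique (h : S ⊆ T) (φ : A S →ₗ[R] A T) (hφ : ∀ m, φ (loc S m) = loc T m) :
    locRes f loc h = φ :=
  IsLocalizedModule.lift_unique _ _ _ _ _ (LinearMap.ext hφ)

theorem locRes_refl (S : Finset (Fin s)) : locRes f loc (Finset.Subset.refl S) = LinearMap.id :=
  locRes_unique f loc _ _ fun _ => rfl

theorem locRes_locRes {U : Finset (Fin s)} (h : S ⊆ T) (h' : T ⊆ U) (x : A S) :
    locRes f loc h' (locRes f loc h x) = locRes f loc (h.trans h') x := by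
  rw [locRes_unique f loc (h.trans h') (locRes f loc h' ∘ₗ locRes f loc h) (by simp)]
  rfl

include hloc in
theorem exists_prod_pow_smul_eq_loc (x : A S) :
    ∃ (k : ℕ) (m : M), (∏ i ∈ S, f i) ^ k • x = loc S m := by
  obtain ⟨⟨m, ⟨_, k, rfl⟩⟩, h⟩ := IsLocalizedModule.surj (prodPowers f S) (loc S) x
  exact ⟨k, m, h⟩

include hloc in
theorem loc_eq_zero_iff {m : M} : loc S m = 0 ↔ ∃ k : ℕ, (∏ i ∈ S, f i) ^ k • m = 0 := by
  simp [IsLocalizedModule.eq_zero_iff (prodPowers f S) (loc S), Submonoid.mem_powers_iff,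
    Submonoid.smul_def]

variable {i : Fin s}

theorem exists_locRes_insert_eq_pow_smul (hi : i ∉ S) (y : A (insert i S)) :
    ∃ (k : ℕ) (x : A S), locRes f loc (Finset.subset_insert i S) x = f i ^ k • y := by
  obtain ⟨k, m, hm⟩ := exists_prod_pow_smul_eq_loc f loc y
  obtain ⟨x, hx⟩ := (prod_pow_smul_bijective f loc (subset_refl S) k).2 (loc S m)
  refine ⟨k, x, (prod_pow_smul_bijective f loc (Finset.subset_insert i S) k).1 ?_⟩
  simp only at hx ⊢
  rw [← map_smul, hx, locRes_loc, ← hm, Finset.prod_insert hi, smul_smul, mul_pow, mul_comm]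

theorem exists_pow_smul_eq_zero_of_locRes_insert (hi : i ∉ S) {x : A S}
    (hx : locRes f loc (Finset.subset_insert i S) x = 0) : ∃ k : ℕ, f i ^ k • x = 0 := by
  obtain ⟨k, m, hm⟩ := exists_prod_pow_smul_eq_loc f loc x
  have hm0 : loc (insert i S) m = 0 := by
    rw [← locRes_loc f loc (Finset.subset_insert i S), ← hm, map_smul, hx, smul_zero]
  obtain ⟨l, hl⟩ := (loc_eq_zero_iff f loc).1 hm0
  refine ⟨l, (prod_pow_smul_bijective f loc (subset_refl S) (l + k)).1 ?_⟩
  simp only [smul_zero]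
  rw [smul_comm, pow_add, mul_smul, hm, ← map_smul, ← map_smul, smul_smul, ← mul_pow,
    ← Finset.prod_insert hi, hl, map_zero]

/-- The Čech differential on cochains of all degrees at once: the component `c S` of a cochain
lies in `M_{f_S}`. -/
def totalCechDiff : Module.End R (∀ S, A S) :=
  LinearMap.pi fun T => ∑ i ∈ T, (-1 : ℤ) ^ (T.filter (· < i)).card •
    locRes f loc (T.erase_subset i) ∘ₗ LinearMap.proj (T.erase i)

theorem totalCechDiff_apply (c : ∀ S, A S) (T : Finset (Fin s)) :
    totalCechDiff f loc c T = ∑ i ∈ T, (-1 : ℤ) ^ (T.filter (· < i)).card •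
      locRes f loc (T.erase_subset i) (c (T.erase i)) := by
  simp [totalCechDiff]

-- Inside the fixed module `M_{f_T}` the Čech differential is the Koszul differential of the
-- identity operators.
theorem locRes_totalCechDiff (c : ∀ S, A S) (h : S ⊆ T) :
    locRes f loc h (totalCechDiff f loc c S) = koszulDiff (fun _ => (1 : Module.End R (A T)))
      (fun S' => if h' : S' ⊆ T then locRes f loc h' (c S') else 0) S := by
  rw [totalCechDiff_apply, map_sum, koszulDiff_apply]
  refine Finset.sum_congr rfl fun i _ => ?_
  rw [map_zsmul, locRes_locRes, dif_pos ((S.erase_subset i).trans h), Module.End.one_apply]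

theorem totalCechDiff_totalCechDiff (c : ∀ S, A S) :
    totalCechDiff f loc (totalCechDiff f loc c) = 0 := by
  funext T
  rw [← LinearMap.id_apply (R := R) (totalCechDiff f loc _ T), ← locRes_refl f loc T,
    locRes_totalCechDiff, Pi.zero_apply,
    ← koszulDiff_koszulDiff (R := R) (fun _ _ => Commute.refl 1)
      (fun S' => if h' : S' ⊆ T then locRes f loc h' (c S') else 0) T]
  refine koszulDiff_congr fun i _ => ?_
  rw [dif_pos (T.erase_subset i), locRes_totalCechDiff]

theorem totalCechDiff_insert_of_eq_zero {c : ∀ S, A S} (hi : i ∉ S) (hc : ∀ T, i ∈ T → c T = 0) :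
    totalCechDiff f loc c (insert i S) = (-1 : ℤ) ^ ((insert i S).filter (· < i)).card •
      locRes f loc (Finset.subset_insert i S) (c S) := by
  have hcongr {S' : Finset (Fin s)} (h : S' ⊆ insert i S) (hS' : S' = S) :
      locRes f loc h (c S') = locRes f loc (Finset.subset_insert i S) (c S) := by
    subst hS'
    rfl
  rw [totalCechDiff_apply, Finset.sum_eq_single i, hcongr _ (Finset.erase_insert hi)]
  · intro j _ hji
    rw [hc _ (Finset.mem_erase.2 ⟨hji.symm, Finset.mem_insert_self i S⟩), map_zero, smul_zero]
  · exact fun h => (h (Finset.mem_insert_self i S)).elim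

theorem exists_pow_smul_eq_totalCechDiff_of_mem (i : Fin s) (c : ∀ S, A S) :
    ∃ (k : ℕ) (b : ∀ S, A S), ∀ T, i ∈ T → f i ^ k • c T = totalCechDiff f loc b T := by
  have hlift (S : Finset (Fin s)) : ∃ (k : ℕ) (x : A S), i ∉ S →
      locRes f loc (Finset.subset_insert i S) x = f i ^ k • c (insert i S) := by
    by_cases hi : i ∈ S
    · exact ⟨0, 0, fun h => (h hi).elim⟩
    · obtain ⟨k, x, hx⟩ := exists_locRes_insert_eq_pow_smul f loc hi (c (insert i S))
      exact ⟨k, x, fun _ => hx⟩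
  choose k x hx using hlift
  let b : ∀ S, A S := fun S => if i ∈ S then 0 else
    (-1 : ℤ) ^ ((insert i S).filter (· < i)).card • f i ^ (Finset.univ.sup k - k S) • x S
  refine ⟨Finset.univ.sup k, b, fun T hT => ?_⟩
  obtain ⟨S, hi, rfl⟩ : ∃ S, i ∉ S ∧ insert i S = T :=
    ⟨T.erase i, Finset.notMem_erase _ _, Finset.insert_erase hT⟩
  have hk : k S ≤ Finset.univ.sup k := Finset.le_sup (Finset.mem_univ S)
  rw [totalCechDiff_insert_of_eq_zero f loc hi fun T hT => if_pos hT]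
  rw [if_neg hi, map_zsmul, map_smul, hx S hi, smul_smul, ← mul_pow, smul_smul, ← pow_add,
    Nat.sub_add_cancel hk]
  simp

theorem exists_pow_smul_eq_zero_of_totalCechDiff_eq_zero {e : ∀ S, A S} {p : ℕ}
    (he : ∀ T, i ∈ T → e T = 0) (hde : ∀ T, T.card = p + 1 → totalCechDiff f loc e T = 0) :
    ∃ k : ℕ, ∀ S, S.card = p → f i ^ k • e S = 0 := by
  have hS (S : Finset (Fin s)) : ∃ k : ℕ, S.card = p → f i ^ k • e S = 0 := by
    by_cases hi : i ∈ S
    · exact ⟨0, fun _ => by rw [he S hi, smul_zero]⟩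
    by_cases hp : S.card = p
    · have hinsert := hde (insert i S) (by rw [Finset.card_insert_of_notMem hi, hp])
      rw [totalCechDiff_insert_of_eq_zero f loc hi he,
        ((isUnit_one.neg).pow _).smul_eq_zero] at hinsert
      obtain ⟨k, hk⟩ := exists_pow_smul_eq_zero_of_locRes_insert f loc hi hinsert
      exact ⟨k, fun _ => hk⟩
    · exact ⟨0, fun h => (hp h).elim⟩
  choose k hk using hS
  refine ⟨Finset.univ.sup k, fun S hS => ?_⟩
  rw [← Nat.sub_add_cancel (Finset.le_sup (f := k) (Finset.mem_univ S)), pow_add, mul_smul,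
    hk S hS, smul_zero]

theorem exists_pow_smul_eq_totalCechDiff (i : Fin s) {p : ℕ} {c : ∀ S, A S}
    (hc : ∀ T, T.card = p + 1 → totalCechDiff f loc c T = 0) :
    ∃ (k : ℕ) (b : ∀ S, A S), ∀ S, S.card = p → f i ^ k • c S = totalCechDiff f loc b S := by
  obtain ⟨k, b, hb⟩ := exists_pow_smul_eq_totalCechDiff_of_mem f loc i c
  obtain ⟨l, hl⟩ := exists_pow_smul_eq_zero_of_totalCechDiff_eq_zero f loc (i := i) (p := p)
    (e := f i ^ k • c - totalCechDiff f loc b) (fun T hT => by simp [hb T hT])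
    (fun T hT => by simp [totalCechDiff_totalCechDiff, hc T hT])
  refine ⟨l + k, f i ^ l • b, fun S hS => ?_⟩
  have h := hl S hS
  rw [Pi.sub_apply, Pi.smul_apply, smul_sub, sub_eq_zero] at h
  rw [map_smul, Pi.smul_apply, ← h, pow_add, mul_smul]

end CechCochains

/-! ### The connecting map of multiplication by a regular element -/

section ModuleCohomology

variable {R : Type*} [CommRing R] {C : ℕ → Type*} [∀ p, AddCommGroup (C p)] [∀ p, Module R (C p)]

/-- The coboundaries in degree `p` of a cochain complex of modules over a commutative ring. -/
def moduleCoboundaries (d : ∀ p, C p →ₗ[R] C (p + 1)) : ∀ p, Submodule R (C p)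
  | 0 => ⊥
  | p + 1 => LinearMap.range (d p)

/-- The cohomology in degree `p` of a cochain complex of modules over a commutative ring. -/
abbrev ModuleCohomology (d : ∀ p, C p →ₗ[R] C (p + 1)) (p : ℕ) : Type _ :=
  LinearMap.ker (d p) ⧸ (moduleCoboundaries d p).submoduleOf (LinearMap.ker (d p))

theorem subsingleton_moduleCohomology_iff {d : ∀ p, C p →ₗ[R] C (p + 1)} {p : ℕ} :
    Subsingleton (ModuleCohomology d p) ↔ ∀ c, d p c = 0 → c ∈ moduleCoboundaries d p := by
  rw [Submodule.Quotient.subsingleton_iff, Submodule.submoduleOf_eq_top]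
  rfl

theorem exists_injective_comp_eq_of_ker_eq {E M N : Type*} [AddCommGroup E] [AddCommGroup M]
    [AddCommGroup N] [Module R E] [Module R M] [Module R N] {q : E →ₗ[R] M} {r : E →ₗ[R] N}
    (hq : Function.Surjective q) (hker : LinearMap.ker q = LinearMap.ker r) :
    ∃ δ : M →ₗ[R] N, Function.Injective δ ∧ δ ∘ₗ q = r := by
  let e : M ≃ₗ[R] LinearMap.range r := (q.quotKerEquivOfSurjective hq).symm ≪≫ₗ
    Submodule.quotEquivOfEq _ _ hker ≪≫ₗ r.quotKerEquivRange
  refine ⟨(LinearMap.range r).subtype ∘ₗ e.toLinearMap,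
    (LinearMap.range r).injective_subtype.comp e.injective, LinearMap.ext fun x => ?_⟩
  have hx : (q.quotKerEquivOfSurjective hq).symm (q x) = Submodule.Quotient.mk x :=
    (q.quotKerEquivOfSurjective hq).symm_apply_eq.2 rfl
  simp [e, hx]

variable {C' : ℕ → Type*} [∀ p, AddCommGroup (C' p)] [∀ p, Module R (C' p)]

/-- Exactness of the sequence of cochain complexes `0 → (C, d) → (C, d) → (C', d') → 0` whose maps
are multiplication by `g` and `π`. -/
structure IsSMulShortExact (d : ∀ p, C p →ₗ[R] C (p + 1)) (d' : ∀ p, C' p →ₗ[R] C' (p + 1))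
    (π : ∀ p, C p →ₗ[R] C' p) (g : R) : Prop where
  diff_diff : ∀ p c, d (p + 1) (d p c) = 0
  map_diff : ∀ p c, π (p + 1) (d p c) = d' p (π p c)
  surjective : ∀ p, Function.Surjective (π p)
  isSMulRegular : ∀ p, IsSMulRegular (C p) g
  map_eq_zero_iff : ∀ p c, π p c = 0 ↔ ∃ b, g • b = c

/-- The pairs `(c, b)` with `d c = g b`. In the situation of `IsSMulShortExact`, `c` lifts a cocycle
of `C'` and `b` represents the image of its class under the connecting map. -/
def liftedCocycles (d : ∀ p, C p →ₗ[R] C (p + 1)) (g : R) (p : ℕ) :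
    Submodule R (C p × C (p + 1)) :=
  LinearMap.eqLocus (d p ∘ₗ LinearMap.fst R _ _) (g • LinearMap.snd R _ _)

namespace IsSMulShortExact

variable {d : ∀ p, C p →ₗ[R] C (p + 1)} {d' : ∀ p, C' p →ₗ[R] C' (p + 1)}
  {π : ∀ p, C p →ₗ[R] C' p} {g : R}

theorem map_smul_eq_zero (h : IsSMulShortExact d d' π g) {p : ℕ} (c : C p) : π p (g • c) = 0 :=
  (h.map_eq_zero_iff p _).2 ⟨c, rfl⟩

theorem diff_eq_zero_of_mem_moduleCoboundaries (h : IsSMulShortExact d d' π g) {p : ℕ} {c : C p}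
    (hc : c ∈ moduleCoboundaries d p) : d p c = 0 := by
  cases p with
  | zero => rw [show c = 0 from hc, map_zero]
  | succ p =>
    obtain ⟨b, rfl⟩ := hc
    exact h.diff_diff p b

theorem map_moduleCoboundaries (h : IsSMulShortExact d d' π g) (p : ℕ) :
    (moduleCoboundaries d p).map (π p) = moduleCoboundaries d' p := by
  cases p with
  | zero => exact Submodule.map_bot _
  | succ p =>
    have hcomm : π (p + 1) ∘ₗ d p = d' p ∘ₗ π p := LinearMap.ext (h.map_diff p)
    rw [moduleCoboundaries, moduleCoboundaries, ← LinearMap.range_comp, hcomm,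
      LinearMap.range_comp_of_range_eq_top _ (LinearMap.range_eq_top.2 (h.surjective p))]

/-- The class in `H^p(C')` of the cocycle `π c`, for `(c, b)` with `d c = g b`. -/
def fstClass (h : IsSMulShortExact d d' π g) (p : ℕ) :
    liftedCocycles d g p →ₗ[R] ModuleCohomology d' p :=
  Submodule.mkQ _ ∘ₗ (π p ∘ₗ LinearMap.fst R _ _ ∘ₗ Submodule.subtype _).codRestrict
    (LinearMap.ker (d' p)) fun x => by
      have hx : d p x.1.1 = g • x.1.2 := x.2
      simp [← h.map_diff, hx, h.map_smul_eq_zero]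

/-- The class in `H^{p+1}(C)` of the cocycle `b`, for `(c, b)` with `d c = g b`. -/
def sndClass (h : IsSMulShortExact d d' π g) (p : ℕ) :
    liftedCocycles d g p →ₗ[R] ModuleCohomology d (p + 1) :=
  Submodule.mkQ _ ∘ₗ (LinearMap.snd R _ _ ∘ₗ Submodule.subtype _).codRestrict
    (LinearMap.ker (d (p + 1))) fun x => by
      have hx : d p x.1.1 = g • x.1.2 := x.2
      refine h.isSMulRegular _ ?_
      simp [← map_smul, ← hx, h.diff_diff]

variable {p : ℕ}

theorem fstClass_eq_zero_iff (h : IsSMulShortExact d d' π g) (x : liftedCocycles d g p) :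
    h.fstClass p x = 0 ↔ π p x.1.1 ∈ moduleCoboundaries d' p :=
  Submodule.Quotient.mk_eq_zero _

theorem sndClass_eq_zero_iff (h : IsSMulShortExact d d' π g) (x : liftedCocycles d g p) :
    h.sndClass p x = 0 ↔ ∃ c, d p c = x.1.2 :=
  Submodule.Quotient.mk_eq_zero _

theorem fstClass_surjective (h : IsSMulShortExact d d' π g) :
    Function.Surjective (h.fstClass p) := by
  intro z
  obtain ⟨⟨c, hc⟩, rfl⟩ := Submodule.mkQ_surjective _ z
  obtain ⟨a, rfl⟩ := h.surjective p c
  rw [LinearMap.mem_ker, ← h.map_diff, h.map_eq_zero_iff] at hc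
  obtain ⟨b, hb⟩ := hc
  exact ⟨⟨(a, b), hb.symm⟩, rfl⟩

theorem range_sndClass (h : IsSMulShortExact d d' π g) :
    LinearMap.range (h.sndClass p) = Submodule.torsionBy R (ModuleCohomology d (p + 1)) g := by
  ext z
  constructor
  · rintro ⟨x, rfl⟩
    rw [Submodule.mem_torsionBy_iff, ← map_smul]
    exact (h.sndClass_eq_zero_iff _).2 ⟨x.1.1, x.2⟩
  · intro hz
    obtain ⟨⟨b, hb⟩, rfl⟩ := Submodule.mkQ_surjective _ z
    obtain ⟨c, hc⟩ := (Submodule.Quotient.mk_eq_zero _).1 hz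
    exact ⟨⟨(c, b), hc⟩, rfl⟩

theorem ker_fstClass_eq_ker_sndClass (h : IsSMulShortExact d d' π g)
    (hp : Subsingleton (ModuleCohomology d p)) :
    LinearMap.ker (h.fstClass p) = LinearMap.ker (h.sndClass p) := by
  rw [subsingleton_moduleCohomology_iff] at hp
  ext ⟨⟨c, b⟩, hcb⟩
  have hcb : d p c = g • b := hcb
  rw [LinearMap.mem_ker, LinearMap.mem_ker, h.fstClass_eq_zero_iff, h.sndClass_eq_zero_iff,
    ← h.map_moduleCoboundaries]
  constructor
  · rintro ⟨a, ha, hac⟩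
    obtain ⟨c', hc'⟩ := (h.map_eq_zero_iff p (c - a)).1 (by rw [map_sub, hac, sub_self])
    refine ⟨c', h.isSMulRegular _ ?_⟩
    simp only
    rw [← map_smul, hc', map_sub, h.diff_eq_zero_of_mem_moduleCoboundaries ha, sub_zero, hcb]
  · rintro ⟨c', hc'⟩
    have hcoboundary : c - g • c' ∈ moduleCoboundaries d p :=
      hp _ (by rw [map_sub, map_smul, hc', hcb, sub_self])
    exact ⟨_, hcoboundary, by rw [map_sub, h.map_smul_eq_zero, sub_zero]⟩

theorem exists_connecting (h : IsSMulShortExact d d' π g)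
    (hp : Subsingleton (ModuleCohomology d p)) :
    ∃ δ : ModuleCohomology d' p →ₗ[R] ModuleCohomology d (p + 1), Function.Injective δ ∧
      LinearMap.range δ = Submodule.torsionBy R (ModuleCohomology d (p + 1)) g := by
  obtain ⟨δ, hδ, hcomp⟩ := exists_injective_comp_eq_of_ker_eq h.fstClass_surjective
    (h.ker_fstClass_eq_ker_sndClass hp)
  refine ⟨δ, hδ, ?_⟩
  rw [← h.range_sndClass, ← hcomp,
    LinearMap.range_comp_of_range_eq_top _ (LinearMap.range_eq_top.2 h.fstClass_surjective)]

end IsSMulShortExact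

end ModuleCohomology

/-! ### Čech cohomology with coefficients in a module -/

section CechCohomology

variable {R : Type*} [CommRing R] {s : ℕ} (f : Fin s → R)
  {M : Type*} [AddCommGroup M] [Module R M] {A : Finset (Fin s) → Type*}
  [∀ S, AddCommGroup (A S)] [∀ S, Module R (A S)] (loc : ∀ S, M →ₗ[R] A S)
  [hloc : ∀ S, IsLocalizedModule (prodPowers f S) (loc S)] {p : ℕ}

/-- The Čech differential of a module `M` from degree `p` to degree `p + 1`, where `A S` is the
localization `M_{f_S}`. -/
def cechModuleDiff (p : ℕ) :
    (∀ S : Subsets s p, A S.1) →ₗ[R] (∀ T : Subsets s (p + 1), A T.1) :=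
  LinearMap.pi fun T => ∑ i : {i // i ∈ T.1}, (-1 : ℤ) ^ (T.1.filter (· < i.1)).card •
    locRes f loc (T.1.erase_subset i.1) ∘ₗ LinearMap.proj (T.erase i)

/-- The Čech cohomology of a module `M`, where `A S` is the localization `M_{f_S}`. -/
abbrev CechCohomology (p : ℕ) : Type _ :=
  ModuleCohomology (C := fun p => ∀ S : Subsets s p, A S.1) (cechModuleDiff f loc) p

theorem cechModuleDiff_apply (c : ∀ S : Subsets s p, A S.1) (T : Subsets s (p + 1)) :
    cechModuleDiff f loc p c T = ∑ i : {i // i ∈ T.1}, (-1 : ℤ) ^ (T.1.filter (· < i.1)).card •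
      locRes f loc (T.1.erase_subset i.1) (c (T.erase i)) := by
  simp [cechModuleDiff]

theorem cechModuleDiff_restrict (c : ∀ S, A S) (T : Subsets s (p + 1)) :
    cechModuleDiff f loc p (fun S => c S.1) T = totalCechDiff f loc c T.1 := by
  rw [totalCechDiff_apply, cechModuleDiff_apply]
  exact Finset.sum_coe_sort T.1 fun i => (-1 : ℤ) ^ (T.1.filter (· < i)).card •
    locRes f loc (T.1.erase_subset i) (c (T.1.erase i))

theorem cechModuleDiff_cechModuleDiff (c : ∀ S : Subsets s p, A S.1) :
    cechModuleDiff f loc (p + 1) (cechModuleDiff f loc p c) = 0 := by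
  obtain ⟨b, rfl⟩ := Subtype.exists_pi_extension (α := A) c
  have hrestrict : cechModuleDiff f loc p (fun S => b S.1) =
      fun T : Subsets s (p + 1) => totalCechDiff f loc b T.1 :=
    funext (cechModuleDiff_restrict f loc b)
  funext T
  rw [hrestrict, cechModuleDiff_restrict, totalCechDiff_totalCechDiff]
  rfl

theorem restrict_totalCechDiff_mem_moduleCoboundaries (b : ∀ S, A S) (p : ℕ) :
    (fun S : Subsets s p => totalCechDiff f loc b S.1) ∈
      moduleCoboundaries (C := fun p => ∀ S : Subsets s p, A S.1) (cechModuleDiff f loc) p := by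
  cases p with
  | zero =>
    refine funext fun S => ?_
    obtain ⟨S, hS⟩ := S
    obtain rfl := Finset.card_eq_zero.1 hS
    simp [totalCechDiff_apply]
  | succ p => exact ⟨fun S => b S.1, funext (cechModuleDiff_restrict f loc b)⟩

theorem exists_pow_smul_eq_zero_of_generator (i : Fin s) (z : CechCohomology f loc p) :
    ∃ k : ℕ, f i ^ k • z = 0 := by
  obtain ⟨⟨c, hc⟩, rfl⟩ := Submodule.mkQ_surjective _ z
  obtain ⟨a, rfl⟩ := Subtype.exists_pi_extension (α := A) c
  obtain ⟨k, b, hb⟩ := exists_pow_smul_eq_totalCechDiff f loc (p := p) i (c := a) fun T hT =>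
    (cechModuleDiff_restrict f loc a ⟨T, hT⟩).symm.trans (congrFun hc ⟨T, hT⟩)
  have hrestrict : f i ^ k • (fun S : Subsets s p => a S.1) =
      fun S : Subsets s p => totalCechDiff f loc b S.1 :=
    funext fun S => hb S.1 S.2
  have hmem := restrict_totalCechDiff_mem_moduleCoboundaries f loc b p
  rw [← hrestrict] at hmem
  exact ⟨k, (Submodule.Quotient.mk_eq_zero _).2 hmem⟩

theorem exists_pow_smul_eq_zero_of_mem_radical {g : R}
    (hg : g ∈ (Ideal.span (Set.range f)).radical) (z : CechCohomology f loc p) :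
    ∃ k : ℕ, g ^ k • z = 0 := by
  have hspan : Ideal.span (Set.range f) ≤ (Ideal.torsionOf R _ z).radical := by
    rw [Ideal.span_le]
    rintro _ ⟨i, rfl⟩
    exact exists_pow_smul_eq_zero_of_generator f loc i z
  exact Ideal.radical_le_radical_iff.2 hspan hg

/-- The submodule `Γ_I(M)` of elements of `M` killed by a power of `f_i` for every `i`, where
`I = (f_1, …, f_s)`. -/
def torsionSections (M : Type*) [AddCommGroup M] [Module R M] : Submodule R M :=
  ⨅ i, Submodule.torsion' R M (Submonoid.powers (f i))

theorem mem_torsionSections {m : M} :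
    m ∈ torsionSections f M ↔ ∀ i, ∃ k : ℕ, f i ^ k • m = 0 := by
  simp [torsionSections, Submodule.mem_torsion'_iff, Submonoid.mem_powers_iff, Submonoid.smul_def]

include hloc in
theorem loc_empty_bijective : Function.Bijective (loc ∅) := by
  constructor
  · rw [← LinearMap.ker_eq_bot, LinearMap.ker_eq_bot']
    intro m hm
    obtain ⟨k, hk⟩ := (loc_eq_zero_iff f loc).1 hm
    simpa using hk
  · intro x
    obtain ⟨k, m, hm⟩ := exists_prod_pow_smul_eq_loc f loc x
    exact ⟨m, by simpa using hm.symm⟩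

theorem cechModuleDiff_zero_loc_eq_zero_iff {m : M} :
    cechModuleDiff f loc 0 (fun S => loc S.1 m) = 0 ↔ m ∈ torsionSections f M := by
  have hsingleton (i : Fin s) :
      totalCechDiff f loc (fun S => loc S m) {i} = 0 ↔ ∃ k : ℕ, f i ^ k • m = 0 := by
    simp [totalCechDiff_apply, Finset.filter_singleton, loc_eq_zero_iff f loc]
  simp only [mem_torsionSections, ← hsingleton]
  constructor
  · exact fun h i => (cechModuleDiff_restrict f loc _ ⟨{i}, Finset.card_singleton i⟩).symm.trans
      (congrFun h _)
  · intro h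
    funext ⟨T, hT⟩
    obtain ⟨i, rfl⟩ := Finset.card_eq_one.1 hT
    rw [cechModuleDiff_restrict f loc fun S => loc S m]
    exact h i

theorem nonempty_torsionSections_equiv_cechCohomology_zero :
    Nonempty (torsionSections f M ≃ₗ[R] CechCohomology f loc 0) := by
  let Δ : torsionSections f M →ₗ[R] CechCohomology f loc 0 := Submodule.mkQ _ ∘ₗ
    ((LinearMap.pi fun S : Subsets s 0 => loc S.1) ∘ₗ Submodule.subtype _).codRestrict
      (LinearMap.ker (cechModuleDiff f loc 0))
      fun m => (cechModuleDiff_zero_loc_eq_zero_iff f loc).2 m.2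
  refine ⟨LinearEquiv.ofBijective Δ ⟨?_, fun z => ?_⟩⟩
  · rw [← LinearMap.ker_eq_bot, LinearMap.ker_eq_bot']
    intro m hm
    have hloc0 : loc ∅ m.1 = 0 :=
      congrFun (show (fun S : Subsets s 0 => loc S.1 m.1) = 0 from
        (Submodule.Quotient.mk_eq_zero _).1 hm) ⟨∅, rfl⟩
    exact Subtype.ext ((loc_empty_bijective f loc).1 (hloc0.trans (map_zero _).symm))
  · obtain ⟨⟨c, hc⟩, rfl⟩ := Submodule.mkQ_surjective _ z
    obtain ⟨m, hm⟩ := (loc_empty_bijective f loc).2 (c ⟨∅, rfl⟩)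
    obtain rfl : c = fun S : Subsets s 0 => loc S.1 m := by
      funext ⟨S, hS⟩
      obtain rfl := Finset.card_eq_zero.1 hS
      exact hm.symm
    exact ⟨⟨m, (cechModuleDiff_zero_loc_eq_zero_iff f loc).1 hc⟩, rfl⟩

end CechCohomology

section CechConnecting

variable {R : Type*} [CommRing R] {s : ℕ} (f : Fin s → R)
  {M : Type*} [AddCommGroup M] [Module R M] {A : Finset (Fin s) → Type*}
  [∀ S, AddCommGroup (A S)] [∀ S, Module R (A S)] (loc : ∀ S, M →ₗ[R] A S)
  [hloc : ∀ S, IsLocalizedModule (prodPowers f S) (loc S)]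
  {M' : Type*} [AddCommGroup M'] [Module R M'] {A' : Finset (Fin s) → Type*}
  [∀ S, AddCommGroup (A' S)] [∀ S, Module R (A' S)] (loc' : ∀ S, M' →ₗ[R] A' S)
  [hloc' : ∀ S, IsLocalizedModule (prodPowers f S) (loc' S)]

theorem map_locRes (φ : M →ₗ[R] M') {S T : Finset (Fin s)} (h : S ⊆ T) (x : A S) :
    IsLocalizedModule.map (prodPowers f T) (loc T) (loc' T) φ (locRes f loc h x) =
      locRes f loc' h (IsLocalizedModule.map (prodPowers f S) (loc S) (loc' S) φ x) := by
  suffices hcomp : IsLocalizedModule.map (prodPowers f T) (loc T) (loc' T) φ ∘ₗ locRes f loc h =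
      locRes f loc' h ∘ₗ IsLocalizedModule.map (prodPowers f S) (loc S) (loc' S) φ from
    LinearMap.congr_fun hcomp x
  refine IsLocalizedModule.ext (prodPowers f S) (loc S) (isUnit_algebraMap_prodPowers f loc' h) ?_
  ext m
  simp

/-- The map of Čech cochains induced by a linear map. -/
def cechModuleMap (φ : M →ₗ[R] M') (p : ℕ) :
    (∀ S : Subsets s p, A S.1) →ₗ[R] (∀ S : Subsets s p, A' S.1) :=
  LinearMap.pi fun S =>
    IsLocalizedModule.map (prodPowers f S.1) (loc S.1) (loc' S.1) φ ∘ₗ LinearMap.proj S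

theorem cechModuleMap_cechModuleDiff (φ : M →ₗ[R] M') (p : ℕ)
    (c : ∀ S : Subsets s p, A S.1) :
    cechModuleMap f loc loc' φ (p + 1) (cechModuleDiff f loc p c) =
      cechModuleDiff f loc' p (cechModuleMap f loc loc' φ p c) := by
  funext T
  rw [cechModuleDiff_apply]
  simp only [cechModuleMap, LinearMap.pi_apply, LinearMap.comp_apply, LinearMap.proj_apply,
    cechModuleDiff_apply, map_sum, map_zsmul, map_locRes f loc loc']

theorem map_lsmul {P : Submonoid R} {N : Type*} [AddCommGroup N] [Module R N] (ℓ : M →ₗ[R] N)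
    [IsLocalizedModule P ℓ] (g : R) :
    IsLocalizedModule.map P ℓ ℓ (LinearMap.lsmul R M g) = LinearMap.lsmul R N g := by
  refine IsLocalizedModule.linearMap_ext P ℓ ℓ ?_
  ext m
  simp

variable {f loc loc'} {g : R} {φ : M →ₗ[R] M'}

theorem isSMulShortExact_cechModuleDiff (hg : IsSMulRegular M g) (hφ : Function.Surjective φ)
    (hex : Function.Exact (LinearMap.lsmul R M g) φ) :
    IsSMulShortExact (C := fun p => ∀ S : Subsets s p, A S.1)
      (C' := fun p => ∀ S : Subsets s p, A' S.1)
      (cechModuleDiff f loc) (cechModuleDiff f loc') (cechModuleMap f loc loc' φ) g where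
  diff_diff _ := cechModuleDiff_cechModuleDiff f loc
  map_diff := cechModuleMap_cechModuleDiff f loc loc' φ
  surjective p c := by
    choose b hb using fun S : Subsets s p =>
      IsLocalizedModule.map_surjective (prodPowers f S.1) (loc S.1) (loc' S.1) φ hφ (c S)
    exact ⟨b, funext hb⟩
  isSMulRegular p := by
    refine IsSMulRegular.pi fun S => ?_
    have hinj := IsLocalizedModule.map_injective (prodPowers f S.1) (loc S.1) (loc S.1)
      (LinearMap.lsmul R M g) hg
    rwa [map_lsmul] at hinj
  map_eq_zero_iff p c := by
    have hexact (S : Subsets s p) := IsLocalizedModule.map_exact (prodPowers f S.1) (loc S.1)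
      (loc S.1) (loc' S.1) _ _ hex
    simp only [map_lsmul] at hexact
    constructor
    · intro h
      choose b hb using fun S => (hexact S (c S)).1 (congrFun h S)
      exact ⟨b, funext hb⟩
    · rintro ⟨b, rfl⟩
      exact funext fun S => (hexact S _).2 ⟨b S, rfl⟩

end CechConnecting

section RegularSequence

open RingTheory.Sequence
open scoped Pointwise

/-- The isomorphism `Γ_I(M) ≃ Γ_I(M')` induced by an isomorphism `M ≃ M'`. -/
def torsionSectionsCongr {R : Type*} [CommRing R] {s : ℕ} (f : Fin s → R) {M M' : Type*}
    [AddCommGroup M] [Module R M] [AddCommGroup M'] [Module R M'] (e : M ≃ₗ[R] M') :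
    torsionSections f M ≃ₗ[R] torsionSections f M' :=
  e.ofSubmodules _ _ <| by
    ext m
    simp [Submodule.mem_map_equiv, mem_torsionSections, ← map_smul]

variable {R : Type u} [CommRing R] {s : ℕ} {f : Fin s → R} {M : Type u} [AddCommGroup M]
  [Module R M] {A : Finset (Fin s) → Type u} [∀ S, AddCommGroup (A S)] [∀ S, Module R (A S)]
  {loc : ∀ S, M →ₗ[R] A S} [∀ S, IsLocalizedModule (prodPowers f S) (loc S)]

theorem exists_cechCohomology_connecting {r : R} (hr : IsSMulRegular M r) {p : ℕ}
    (hp : Subsingleton (CechCohomology f loc p)) :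
    ∃ δ : CechCohomology f (fun S => LocalizedModule.mkLinearMap (prodPowers f S)
        (QuotSMulTop r M)) p →ₗ[R] CechCohomology f loc (p + 1),
      Function.Injective δ ∧ LinearMap.range δ = Submodule.torsionBy R _ r := by
  have hex : Function.Exact (LinearMap.lsmul R M r) (r • ⊤ : Submodule R M).mkQ := fun m => by
    simp [Submodule.mem_smul_pointwise_iff_exists]
  exact (isSMulShortExact_cechModuleDiff hr (Submodule.mkQ_surjective _) hex).exists_connecting hp

theorem subsingleton_cechCohomology_of_smul_eq_zero {g : R}
    (hg : g ∈ (Ideal.span (Set.range f)).radical) {p : ℕ}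
    (hinj : ∀ z : CechCohomology f loc p, g • z = 0 → z = 0) :
    Subsingleton (CechCohomology f loc p) := by
  refine subsingleton_of_forall_eq 0 fun z => ?_
  obtain ⟨k, hk⟩ := exists_pow_smul_eq_zero_of_mem_radical f loc hg z
  induction k with
  | zero => simpa using hk
  | succ k ih => exact ih (hinj _ (by rw [smul_smul, ← pow_succ', hk]))

theorem subsingleton_cechCohomology_of_isWeaklyRegular {rs : List R} (hrs : IsWeaklyRegular M rs)
    (hrad : ∀ r ∈ rs, r ∈ (Ideal.span (Set.range f)).radical) {p : ℕ} (hp : p < rs.length) :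
    Subsingleton (CechCohomology f loc p) := by
  induction rs generalizing p M A with
  | nil => exact (Nat.not_lt_zero p hp).elim
  | cons r rs ih =>
    rw [isWeaklyRegular_cons_iff] at hrs
    rw [List.forall_mem_cons] at hrad
    induction p with
    | zero =>
      obtain ⟨e⟩ := nonempty_torsionSections_equiv_cechCohomology_zero f loc
      refine subsingleton_cechCohomology_of_smul_eq_zero hrad.1 fun z hz => ?_
      have hsymm : r • e.symm z = 0 := by rw [← map_smul, hz, map_zero]
      rw [← e.symm.map_eq_zero_iff]
      exact Subtype.ext (hrs.1.right_eq_zero_of_smul (congrArg Subtype.val hsymm))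
    | succ p ihp =>
      obtain ⟨δ, -, hδ⟩ := exists_cechCohomology_connecting hrs.1 (ihp (by omega))
      have hsub := ih (loc := fun S => LocalizedModule.mkLinearMap (prodPowers f S)
        (QuotSMulTop r M)) hrs.2 hrad.2 (p := p) (by simpa using hp)
      refine subsingleton_cechCohomology_of_smul_eq_zero hrad.1 fun z hz => ?_
      obtain ⟨y, rfl⟩ : z ∈ LinearMap.range δ := hδ ▸ hz
      rw [Subsingleton.elim y 0, map_zero]

theorem exists_torsionSections_quotient_to_cechCohomology {rs : List R}
    (hrs : IsWeaklyRegular M rs) (hrad : ∀ r ∈ rs, r ∈ (Ideal.span (Set.range f)).radical) :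
    ∃ Δ : torsionSections f (M ⧸ (Ideal.ofList rs • ⊤ : Submodule R M)) →ₗ[R]
        CechCohomology f loc rs.length,
      Function.Injective Δ ∧ ∀ z, z ∈ LinearMap.range Δ ↔ ∀ r ∈ rs, r • z = 0 := by
  induction rs generalizing M A with
  | nil =>
    obtain ⟨e⟩ := nonempty_torsionSections_equiv_cechCohomology_zero f loc
    have hbot : (Ideal.ofList ([] : List R) • ⊤ : Submodule R M) = ⊥ := by
      rw [Ideal.ofList_nil, Submodule.bot_smul]
    let e' := torsionSectionsCongr f (Submodule.quotEquivOfEqBot _ hbot) ≪≫ₗ e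
    exact ⟨e'.toLinearMap, e'.injective, fun z => by simp [e'.range]⟩
  | cons r rs ih =>
    obtain ⟨δ, hδ, hδr⟩ := exists_cechCohomology_connecting ((isWeaklyRegular_cons_iff ..).1 hrs).1
      (subsingleton_cechCohomology_of_isWeaklyRegular (f := f) (loc := loc) hrs hrad
        (Nat.lt_succ_self rs.length))
    rw [List.forall_mem_cons] at hrad
    obtain ⟨Δ, hΔ, hΔr⟩ := ih (loc := fun S => LocalizedModule.mkLinearMap (prodPowers f S)
      (QuotSMulTop r M)) ((isWeaklyRegular_cons_iff ..).1 hrs).2 hrad.2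
    let e := torsionSectionsCongr f (Submodule.quotOfListConsSMulTopEquivQuotSMulTopInner M r rs)
    refine ⟨δ ∘ₗ Δ ∘ₗ e.toLinearMap, hδ.comp (hΔ.comp e.injective), fun z => ?_⟩
    have hδz (z) : z ∈ LinearMap.range δ ↔ r • z = 0 := by rw [hδr, Submodule.mem_torsionBy_iff]
    rw [List.forall_mem_cons]
    constructor
    · rintro ⟨y, rfl⟩
      refine ⟨(hδz _).1 ⟨_, rfl⟩, fun r' hr' => ?_⟩
      simp [← map_smul δ, (hΔr _).1 ⟨e y, rfl⟩ r' hr']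
    · rintro ⟨hz, hy⟩
      obtain ⟨y, rfl⟩ := (hδz z).2 hz
      obtain ⟨w, rfl⟩ := (hΔr y).2 fun r' hr' => hδ (by rw [map_smul, map_zero, hy r' hr'])
      exact ⟨e.symm w, by simp⟩

end RegularSequence

/-! ### Polynomials and derivations acting on local cohomology -/

section LocalCohomologyOperators

variable {K R : Type u} [Field K] [CommRing R] [Algebra K R] {s : ℕ} (f : Fin s → R)

/-- The localization map `R → R_{f_S}`. -/
abbrev cechMap (S : Finset (Fin s)) : R →ₗ[R] CechPiece f S := Algebra.linearMap R (CechPiece f S)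

theorem awayMap_eq_locRes {S T : Finset (Fin s)} (h : S ⊆ T) (hd : ∏ i ∈ S, f i ∣ ∏ i ∈ T, f i)
    (x : CechPiece f S) : awayMap (K := K) hd x = locRes f (cechMap f) h x := by
  let awayLinearMap : CechPiece f S →ₗ[R] CechPiece f T :=
    { toFun := awayMap (K := K) hd
      map_add' := map_add _
      map_smul' := fun r x => by simp [Algebra.smul_def, awayMap_algebraMap] }
  rw [locRes_unique f (cechMap f) h awayLinearMap (awayMap_algebraMap hd)]
  rfl

theorem cechDiff_eq_cechModuleDiff (p : ℕ) (c : ∀ S : Subsets s p, CechPiece f S.1) :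
    cechDiff K f p c = cechModuleDiff f (cechMap f) p c := by
  funext T
  rw [cechModuleDiff_apply]
  refine Finset.sum_congr rfl fun i _ => ?_
  rw [sgn_smul, ← awayMap_eq_locRes (K := K) f _ (prod_erase_dvd f T.1 i.1)]
  rfl

theorem ker_cechDiff (p : ℕ) : LinearMap.ker (cechDiff K f p) =
    (LinearMap.ker (cechModuleDiff f (cechMap f) p)).restrictScalars K := by
  ext c
  simp [cechDiff_eq_cechModuleDiff]

theorem coboundaries_cechDiff (p : ℕ) :
    coboundaries (C := fun p => ∀ S : Subsets s p, CechPiece f S.1) (cechDiff K f) p =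
      (moduleCoboundaries (C := fun p => ∀ S : Subsets s p, CechPiece f S.1)
        (cechModuleDiff f (cechMap f)) p).restrictScalars K := by
  cases p with
  | zero => rfl
  | succ p =>
    ext c
    simp [coboundaries, moduleCoboundaries, cechDiff_eq_cechModuleDiff]

/-- The identification of the Čech cocycles of `R` over `K` with those over `R`. -/
def cechCocyclesEquiv (K : Type u) [Field K] [Algebra K R] (f : Fin s → R) (p : ℕ) :
    LinearMap.ker (cechDiff K f p) ≃ₗ[K] LinearMap.ker (cechModuleDiff f (cechMap f) p) :=
  LinearEquiv.ofEq _ ((LinearMap.ker (cechModuleDiff f (cechMap f) p)).restrictScalars K)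
    (ker_cechDiff f p)

/-- The identification of `H^p_I(R)` with the Čech cohomology of the `R`-module `R`, through which
`R` acts on `H^p_I(R)`. -/
def lcEquiv (K : Type u) [Field K] [Algebra K R] (f : Fin s → R) (p : ℕ) :
    LocalCohomology K f p ≃ₗ[K] CechCohomology f (cechMap f) p :=
  let B := (moduleCoboundaries (C := fun p => ∀ S : Subsets s p, CechPiece f S.1)
    (cechModuleDiff f (cechMap f)) p).submoduleOf (LinearMap.ker (cechModuleDiff f (cechMap f) p))
  Submodule.Quotient.equiv _ (B.restrictScalars K) (cechCocyclesEquiv K f p) (by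
      rw [coboundaries_cechDiff]
      ext c
      exact Submodule.mem_map_equiv (e := cechCocyclesEquiv K f p) _) ≪≫ₗ
    Submodule.Quotient.restrictScalarsEquiv K B

/-- Multiplication by elements of `R` on `H^p_I(R)`. -/
def lcMul (K : Type u) [Field K] [Algebra K R] (f : Fin s → R) (p : ℕ) :
    R →ₐ[K] Module.End K (LocalCohomology K f p) :=
  ((lcEquiv K f p).symm.conjAlgEquiv K).toAlgHom.comp (Algebra.lsmul K K _)

theorem lcEquiv_lcMul (p : ℕ) (r : R) (z : LocalCohomology K f p) :
    lcEquiv K f p (lcMul K f p r z) = r • lcEquiv K f p z := by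
  simp [lcMul]

theorem smul_mem_ker_cechDiff {p : ℕ} (r : R) {c : ∀ S : Subsets s p, CechPiece f S.1}
    (hc : c ∈ LinearMap.ker (cechDiff K f p)) : r • c ∈ LinearMap.ker (cechDiff K f p) := by
  rw [ker_cechDiff] at hc ⊢
  exact Submodule.smul_mem (LinearMap.ker (cechModuleDiff f (cechMap f) p)) r hc

theorem lcMul_mk (p : ℕ) (r : R) (c : ∀ S : Subsets s p, CechPiece f S.1)
    (hc : c ∈ LinearMap.ker (cechDiff K f p)) :
    lcMul K f p r (Submodule.Quotient.mk ⟨c, hc⟩) =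
      Submodule.Quotient.mk ⟨r • c, smul_mem_ker_cechDiff f r hc⟩ := by
  apply (lcEquiv K f p).injective
  rw [lcEquiv_lcMul]
  rfl

theorem awayDerivation_smul (D : Derivation K R R) (g r : R) (x : Localization.Away g) :
    awayDerivation D g (r • x) = r • awayDerivation D g x + D r • x := by
  rw [Algebra.smul_def, Derivation.leibniz, awayDerivation_algebraMap, smul_eq_mul,
    smul_eq_mul, mul_comm x, ← Algebra.smul_def, ← Algebra.smul_def]

theorem derivation_away_eq_zero {g : R} {B : Derivation K (Localization.Away g)
    (Localization.Away g)} (hB : ∀ r : R, B (algebraMap R _ r) = 0) : B = 0 := by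
  ext x
  obtain ⟨⟨a, m⟩, hx⟩ := IsLocalization.surj (Submonoid.powers g) x
  have hBx := congrArg B hx
  rwa [hB, Derivation.leibniz, hB, smul_zero, zero_add, smul_eq_mul,
    (IsLocalization.map_units (Localization.Away g) m).mul_right_eq_zero] at hBx

theorem awayDerivation_comm {D D' : Derivation K R R} (h : ∀ r, D (D' r) = D' (D r)) (g : R)
    (x : Localization.Away g) :
    awayDerivation D g (awayDerivation D' g x) = awayDerivation D' g (awayDerivation D g x) := by
  have hbracket : ⁅awayDerivation D g, awayDerivation D' g⁆ = 0 :=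
    derivation_away_eq_zero fun r => by
      simp only [Derivation.commutator_apply, awayDerivation_algebraMap, h, sub_self]
  rw [← sub_eq_zero, ← Derivation.commutator_apply, hbracket, Derivation.zero_apply]

theorem lcDerivation_mk (D : Derivation K R R) (p : ℕ) (c : ∀ S : Subsets s p, CechPiece f S.1)
    (hc : c ∈ LinearMap.ker (cechDiff K f p)) :
    ∃ hc', lcDerivation D f p (Submodule.Quotient.mk ⟨c, hc⟩) =
      Submodule.Quotient.mk ⟨cechDerivation D f p c, hc'⟩ :=
  ⟨_, rfl⟩

theorem lcDerivation_lcMul (D : Derivation K R R) (p : ℕ) (r : R) (z : LocalCohomology K f p) :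
    lcDerivation D f p (lcMul K f p r z) =
      lcMul K f p r (lcDerivation D f p z) + lcMul K f p (D r) z := by
  obtain ⟨⟨c, hc⟩, rfl⟩ := Submodule.Quotient.mk_surjective _ z
  obtain ⟨_, hDc⟩ := lcDerivation_mk f D p c hc
  obtain ⟨_, hDrc⟩ := lcDerivation_mk f D p (r • c) (smul_mem_ker_cechDiff f r hc)
  rw [lcMul_mk, lcMul_mk, hDc, hDrc, lcMul_mk, ← Submodule.Quotient.mk_add]
  congr 1
  exact Subtype.ext (funext fun S => awayDerivation_smul D _ r (c S))

theorem lcDerivation_comm {D D' : Derivation K R R} (h : ∀ r, D (D' r) = D' (D r)) (p : ℕ)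
    (z : LocalCohomology K f p) :
    lcDerivation D f p (lcDerivation D' f p z) = lcDerivation D' f p (lcDerivation D f p z) := by
  obtain ⟨⟨c, hc⟩, rfl⟩ := Submodule.Quotient.mk_surjective _ z
  obtain ⟨hDc', hDc⟩ := lcDerivation_mk f D p c hc
  obtain ⟨hD'c', hD'c⟩ := lcDerivation_mk f D' p c hc
  obtain ⟨_, hD'Dc⟩ := lcDerivation_mk f D' p _ hDc'
  obtain ⟨_, hDD'c⟩ := lcDerivation_mk f D p _ hD'c'
  rw [hDc, hD'c, hD'Dc, hDD'c]
  congr 1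
  exact Subtype.ext (funext fun S => awayDerivation_comm h _ (c S))

end LocalCohomologyOperators

/-! ### Regular sequences of polynomials in separate variables -/

section SeparateVariables

open MvPolynomial RingTheory.Sequence

variable {A σ : Type*} [CommRing A] (g : σ → Polynomial A)

-- Modulo the other equations `u` is killed by the image of `g k` in `B[X_k]`, where `B` is the
-- quotient ring; that image is monic, hence not a zero divisor.
theorem mem_span_of_aeval_X_mul_mem {k : σ} (hk : (g k).Monic) {U : Set σ} (hU : k ∉ U)
    {u : MvPolynomial σ A}
    (hu : Polynomial.aeval (X k) (g k) * u ∈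
      Ideal.span ((fun j => Polynomial.aeval (X j : MvPolynomial σ A) (g j)) '' U)) :
    u ∈ Ideal.span ((fun j => Polynomial.aeval (X j : MvPolynomial σ A) (g j)) '' U) := by
  classical
  set J := Ideal.span ((fun j => Polynomial.aeval (X j : MvPolynomial σ A) (g j)) '' U)
  let B := MvPolynomial σ A ⧸ J
  let π : MvPolynomial σ A →ₐ[A] B := Ideal.Quotient.mkₐ A J
  let ψ : MvPolynomial σ A →ₐ[A] Polynomial B := aeval fun j =>
    if j = k then Polynomial.X else Polynomial.CAlgHom (R := A) (π (X j))
  have hJ : J ≤ RingHom.ker ψ := by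
    refine Ideal.span_le.2 ?_
    rintro _ ⟨j, hj, rfl⟩
    have hψj : ψ (X j) = Polynomial.CAlgHom (R := A) (π (X j)) := by
      simp [ψ, show j ≠ k from fun h => hU (h ▸ hj)]
    have hπj : π (Polynomial.aeval (X j) (g j)) = 0 :=
      Ideal.Quotient.eq_zero_iff_mem.2 (Ideal.subset_span ⟨j, hj, rfl⟩)
    simp only [SetLike.mem_coe, RingHom.mem_ker]
    rw [← Polynomial.aeval_algHom_apply, hψj, Polynomial.aeval_algHom_apply,
      Polynomial.aeval_algHom_apply, hπj, map_zero]
  have hψk : ψ (Polynomial.aeval (X k) (g k)) = (g k).map (algebraMap A B) := by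
    rw [← Polynomial.aeval_algHom_apply, show ψ (X k) = Polynomial.X by simp [ψ],
      Polynomial.aeval_X_left_eq_map]
  have hψu : ψ u = 0 := by
    have hprod : ψ (Polynomial.aeval (X k) (g k) * u) = 0 := hJ hu
    rw [map_mul, hψk] at hprod
    exact (hk.map (algebraMap A B)).mul_right_eq_zero_iff.1 hprod
  have heval : ((Polynomial.aeval (π (X k))).restrictScalars A).comp ψ = π := by
    ext j
    by_cases hj : j = k <;> simp [ψ, hj]
  refine Ideal.Quotient.eq_zero_iff_mem.1 (show π u = 0 from ?_)
  rw [← heval, AlgHom.comp_apply, hψu, map_zero]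

theorem isWeaklyRegular_ofFn_of_mul_mem {R : Type*} [CommRing R] {n : ℕ} {G : Fin n → R}
    (hG : ∀ k u, G k * u ∈ Ideal.span (G '' Set.Iio k) → u ∈ Ideal.span (G '' Set.Iio k)) :
    IsWeaklyRegular R (List.ofFn G) := by
  refine ⟨fun i hi => ?_⟩
  obtain ⟨k, rfl⟩ : ∃ k : Fin n, k.1 = i := ⟨⟨i, by simpa using hi⟩, rfl⟩
  have hspan : (Ideal.ofList ((List.ofFn G).take k) • ⊤ : Submodule R R) =
      Ideal.span (G '' Set.Iio k) := by
    rw [smul_eq_mul, Ideal.mul_top, Ideal.ofList]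
    congr 1
    ext x
    simp only [List.mem_take_iff_getElem, List.getElem_ofFn, List.length_ofFn, Fin.is_le',
      inf_of_le_left, Set.mem_ofPred_eq, Set.mem_image, Set.mem_Iio, Fin.exists_iff]
    grind
  rw [isSMulRegular_quotient_iff_mem_of_smul_mem, hspan]
  simpa using hG k

theorem isWeaklyRegular_ofFn_aeval_X {n : ℕ} {g : Fin n → Polynomial A} (hg : ∀ i, (g i).Monic) :
    IsWeaklyRegular (MvPolynomial (Fin n) A)
      (List.ofFn fun i => Polynomial.aeval (X i : MvPolynomial (Fin n) A) (g i)) :=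
  isWeaklyRegular_ofFn_of_mul_mem fun k _ =>
    mem_span_of_aeval_X_mul_mem g (hg k) Set.self_notMem_Iio

end SeparateVariables

/-! ### Zero-dimensional ideals -/

section ZeroDimensional

theorem finite_quotient_of_isZeroDimensional (K : Type*) {R : Type u} [Field K] [CommRing R]
    [Algebra K R] [Algebra.FiniteType K R] {I : Ideal R} (hI : IsZeroDimensional I) :
    Module.Finite K (R ⧸ I) := by
  have hartinian : IsArtinian R (R ⧸ I) :=
    (isFiniteLength_iff_isNoetherian_isArtinian.1 (Module.length_ne_top_iff.1 hI.1)).2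
  exact (Module.finite_iff_isArtinianRing K _).2 (isArtinian_of_tower R hartinian)

variable {K R : Type*} [Field K] [PerfectField K] [CommRing R] [Algebra K R]

theorem minpoly_separable_of_isReduced [IsReduced R] {x : R} (hx : IsIntegral K x) :
    (minpoly K x).Separable :=
  PerfectField.separable_iff_squarefree.2 <|
    (minpoly.isRadical K x).squarefree (minpoly.ne_zero hx)

theorem exists_separable_aeval_mem_radical (I : Ideal R) [Module.Finite K (R ⧸ I)] (x : R) :
    ∃ g : Polynomial K, g.Monic ∧ g.Separable ∧ Polynomial.aeval x g ∈ I.radical := by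
  have hfinite : Module.Finite K (R ⧸ I.radical) :=
    Module.Finite.of_surjective (Ideal.Quotient.factorₐ K I.le_radical).toLinearMap
      (Ideal.Quotient.factor_surjective I.le_radical)
  have hreduced : IsReduced (R ⧸ I.radical) :=
    (Ideal.isRadical_iff_quotient_reduced _).1 I.radical_isRadical
  let y : R ⧸ I.radical := Ideal.Quotient.mkₐ K _ x
  have hy : IsIntegral K y := Algebra.IsIntegral.isIntegral y
  refine ⟨minpoly K y, minpoly.monic hy, minpoly_separable_of_isReduced hy, ?_⟩
  rw [← Ideal.Quotient.eq_zero_iff_mem, ← Ideal.Quotient.mkₐ_eq_mk K,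
    ← Polynomial.aeval_algHom_apply]
  exact minpoly.aeval K y

end ZeroDimensional

/-! ### Points of a finite reduced algebra -/

section Points

open MvPolynomial

variable {K : Type*} [Field K]

theorem derivation_eq_zero_of_separable {A M : Type*} [CommRing A] [Algebra K A] [AddCommGroup M]
    [Module A M] [Module K M] [IsScalarTower K A M] (D : Derivation K A M) {g : Polynomial K}
    (hg : g.Separable) {x : A} (hx : Polynomial.aeval x g = 0) : D x = 0 := by
  obtain ⟨a, b, hab⟩ := hg
  have hunit : Polynomial.aeval x b * Polynomial.aeval x (Polynomial.derivative g) = 1 := by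
    simpa [hx] using congrArg (Polynomial.aeval x) hab
  have hderiv : Polynomial.aeval x (Polynomial.derivative g) • D x = 0 := by
    rw [← Derivation.map_aeval, hx, map_zero]
  rw [← one_smul A (D x), ← hunit, mul_smul, hderiv, smul_zero]

theorem formallyUnramified_of_adjoin_eq_top {A : Type*} [CommRing A] [Algebra K A] {s : Set A}
    (hs : Algebra.adjoin K s = ⊤)
    (hsep : ∀ x ∈ s, ∃ g : Polynomial K, g.Separable ∧ Polynomial.aeval x g = 0) :
    Algebra.FormallyUnramified K A := by
  have hD : KaehlerDifferential.D K A = 0 := Derivation.ext_of_adjoin_eq_top s hs fun x hx => by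
    obtain ⟨g, hg, hgx⟩ := hsep x hx
    exact derivation_eq_zero_of_separable _ hg hgx
  refine ⟨(Submodule.subsingleton_iff A).1 (subsingleton_of_bot_eq_top ?_)⟩
  rw [← KaehlerDifferential.span_range_derivation, hD, eq_comm, Submodule.span_eq_bot]
  rintro _ ⟨x, rfl⟩
  rfl

theorem formallyUnramified_quotient_of_separable {σ : Type*} {g : σ → Polynomial K}
    (hg : ∀ i, (g i).Separable) {J : Ideal (MvPolynomial σ K)}
    (hJ : ∀ i, Polynomial.aeval (X i) (g i) ∈ J) :
    Algebra.FormallyUnramified K (MvPolynomial σ K ⧸ J) := by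
  refine formallyUnramified_of_adjoin_eq_top (s := Ideal.Quotient.mkₐ K J '' Set.range X) ?_ ?_
  · rw [← AlgHom.map_adjoin, adjoin_range_X, Algebra.map_top, AlgHom.range_eq_top]
    exact Ideal.Quotient.mkₐ_surjective K J
  · rintro _ ⟨_, ⟨i, rfl⟩, rfl⟩
    refine ⟨g i, hg i, ?_⟩
    rw [Polynomial.aeval_algHom_apply]
    exact Ideal.Quotient.eq_zero_iff_mem.2 (hJ i)

theorem bijective_algHom_comp_mkₐ_maximalSpectrum (K B L : Type*) [Field K] [Field L]
    [Algebra K L] [CommRing B] [Algebra K B] [Ring.KrullDimLE 0 B] :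
    Function.Bijective fun x : Σ m : MaximalSpectrum B, (B ⧸ m.asIdeal) →ₐ[K] L =>
      x.2.comp (Ideal.Quotient.mkₐ K x.1.asIdeal) := by
  have hker (m : MaximalSpectrum B) (φ : (B ⧸ m.asIdeal) →ₐ[K] L) :
      RingHom.ker (φ.comp (Ideal.Quotient.mkₐ K m.asIdeal)) = m.asIdeal := by
    let _ := Ideal.Quotient.field m.asIdeal
    ext b
    rw [RingHom.mem_ker, ← Ideal.Quotient.eq_zero_iff_mem]
    exact map_eq_zero_iff φ φ.toRingHom.injective
  constructor
  · rintro ⟨m, φ⟩ ⟨m', φ'⟩ h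
    obtain rfl : m = m' := by
      ext1
      rw [← hker m φ, ← hker m' φ']
      exact congrArg RingHom.ker h
    rw [show φ = φ' from Ideal.Quotient.algHom_ext K h]
  · intro φ
    have hprime : (RingHom.ker φ).IsPrime := RingHom.ker_isPrime φ
    exact ⟨⟨⟨RingHom.ker φ, hprime.isMaximal'⟩,
      Ideal.Quotient.liftₐ (RingHom.ker φ) φ fun _ h => h⟩, rfl⟩

theorem natCard_algHom_eq_finrank (K B L : Type*) [Field K] [PerfectField K] [Field L]
    [Algebra K L] [IsAlgClosed L] [CommRing B] [Algebra K B] [Module.Finite K B] [IsReduced B] :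
    Nat.card (B →ₐ[K] L) = Module.finrank K B := by
  have hartinian : IsArtinianRing B := isArtinian_of_tower K inferInstance
  let _ (m : MaximalSpectrum B) : Field (B ⧸ m.asIdeal) := Ideal.Quotient.field m.asIdeal
  have _ := Fintype.ofFinite (MaximalSpectrum B)
  rw [← Nat.card_congr (Equiv.ofBijective _ (bijective_algHom_comp_mkₐ_maximalSpectrum K B L)),
    Nat.card_sigma, ((IsArtinianRing.equivPi B).restrictScalars K).toLinearEquiv.finrank_eq,
    Module.finrank_pi_fintype]
  exact Finset.sum_congr rfl fun m _ =>
    AlgHom.natCard_of_splits K (B ⧸ m.asIdeal) L fun _ => IsAlgClosed.splits _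

variable {σ L : Type*} [Field L] [Algebra K L]

/-- The points of `V(I)` with coordinates in `L` as `K`-algebra maps from the coordinate ring. -/
def zeroLocusEquiv (I : Ideal (MvPolynomial σ K)) :
    zeroLocus L I ≃ ((MvPolynomial σ K ⧸ I) →ₐ[K] L) where
  toFun a := Ideal.Quotient.liftₐ I (aeval a.1) (mem_zeroLocus_iff.1 a.2)
  invFun φ := ⟨fun i => φ (Ideal.Quotient.mkₐ K I (X i)), fun p hp => by
    have hφ : aeval (fun i => φ (Ideal.Quotient.mkₐ K I (X i))) =
        φ.comp (Ideal.Quotient.mkₐ K I) := MvPolynomial.algHom_ext fun i => by simp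
    rw [hφ, AlgHom.comp_apply, Ideal.Quotient.mkₐ_eq_mk, Ideal.Quotient.eq_zero_iff_mem.2 hp,
      map_zero]⟩
  left_inv a := Subtype.ext <| funext fun i =>
    (AlgHom.congr_fun (Ideal.Quotient.liftₐ_comp I _ (mem_zeroLocus_iff.1 a.2)) (X i)).trans
      (aeval_X _ _)
  right_inv φ := Ideal.Quotient.algHom_ext K <| MvPolynomial.algHom_ext fun i =>
    (AlgHom.congr_fun (Ideal.Quotient.liftₐ_comp I _ _) (X i)).trans (aeval_X _ _)

theorem zeroLocus_sup_eq {I J : Ideal (MvPolynomial σ K)} (h : J ≤ I.radical) :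
    zeroLocus L (J ⊔ I) = zeroLocus L I :=
  le_antisymm (zeroLocus_anti_mono le_sup_right) <| le_zeroLocus_iff_le_vanishingIdeal.2 <|
    (sup_le h I.le_radical).trans (radical_le_vanishingIdeal_zeroLocus I)

theorem finite_zeroLocus (I : Ideal (MvPolynomial σ K)) [Module.Finite K (MvPolynomial σ K ⧸ I)] :
    (zeroLocus L I).Finite :=
  Set.finite_coe_iff.1 (Finite.of_equiv _ (zeroLocusEquiv I).symm)

theorem ncard_zeroLocus_eq_finrank [PerfectField K] [IsAlgClosed L] (I : Ideal (MvPolynomial σ K))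
    [Module.Finite K (MvPolynomial σ K ⧸ I)] [IsReduced (MvPolynomial σ K ⧸ I)] :
    (zeroLocus L I).ncard = Module.finrank K (MvPolynomial σ K ⧸ I) := by
  rw [← Nat.card_coe_set_eq, Nat.card_congr (zeroLocusEquiv I), natCard_algHom_eq_finrank]

end Points

section TorsionSections

theorem annihilator_eq_of_isCompl {B : Type*} [CommRing B] {𝔞 𝔠 : Ideal B} (h : IsCompl 𝔞 𝔠) :
    𝔞.annihilator = 𝔠 := by
  ext x
  rw [Submodule.mem_annihilator]
  constructor
  · intro hx
    obtain ⟨a, ha, c, hc, hac⟩ := Submodule.mem_sup.1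
      (h.sup_eq_top.ge (Submodule.mem_top (x := (1 : B))))
    rw [← mul_one x, ← hac, mul_add, ← smul_eq_mul x a, hx a ha, zero_add]
    exact 𝔠.mul_mem_left x hc
  · intro hx a ha
    rw [← Submodule.mem_bot B, ← h.inf_eq_bot]
    exact ⟨𝔞.mul_mem_left x ha, 𝔠.mul_mem_right a hx⟩

variable {R : Type*} [CommRing R] {s : ℕ} (f : Fin s → R)

theorem torsionSections_eq_annihilator (B : Type*) [CommRing B] [Algebra R B] [IsReduced B] :
    torsionSections f B =
      ((Ideal.span (Set.range f)).map (algebraMap R B)).annihilator.restrictScalars R := by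
  ext x
  rw [mem_torsionSections, Submodule.restrictScalars_mem, Ideal.map_span,
    Submodule.mem_annihilator_span]
  constructor
  · rintro h ⟨_, _, ⟨i, rfl⟩, rfl⟩
    obtain ⟨k, hk⟩ := h i
    rw [Algebra.smul_def, map_pow] at hk
    have hpow : (x * algebraMap R B (f i)) ^ (k + 1) = 0 := by
      linear_combination (x ^ k * algebraMap R B (f i)) * hk
    exact eq_zero_of_pow_eq_zero hpow
  · refine fun h i => ⟨1, ?_⟩
    rw [pow_one, Algebra.smul_def, mul_comm]
    exact h ⟨_, f i, ⟨i, rfl⟩, rfl⟩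

theorem nonempty_torsionSections_quotient_equiv (J : Ideal R) [IsReduced (R ⧸ J)]
    [IsArtinianRing (R ⧸ J)] :
    Nonempty (torsionSections f (R ⧸ J) ≃ₗ[R] R ⧸ (J ⊔ Ideal.span (Set.range f))) := by
  have hsemisimple := IsArtinianRing.isSemisimpleRing_of_isReduced (R ⧸ J)
  obtain ⟨𝔠, h𝔠⟩ := exists_isCompl ((Ideal.span (Set.range f)).map (algebraMap R (R ⧸ J)))
  have hsections : torsionSections f (R ⧸ J) = 𝔠.restrictScalars R := by
    rw [torsionSections_eq_annihilator, annihilator_eq_of_isCompl h𝔠]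
  exact ⟨LinearEquiv.ofEq _ _ hsections ≪≫ₗ
    ((Submodule.quotientEquivOfIsCompl _ 𝔠 h𝔠).restrictScalars R).symm ≪≫ₗ
    (DoubleQuot.quotQuotEquivQuotSupₐ R J _).toLinearEquiv⟩

end TorsionSections

/-! ### The Weyl algebra action on local cohomology -/

section CommonKernel

open RingTheory.Sequence

variable {R : Type u} [CommRing R] {n s : ℕ} {f : Fin s → R} {G : Fin n → R}

theorem exists_torsionSections_span_to_cechCohomology {A : Finset (Fin s) → Type u}
    [∀ S, AddCommGroup (A S)] [∀ S, Module R (A S)] {loc : ∀ S, R →ₗ[R] A S}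
    [∀ S, IsLocalizedModule (prodPowers f S) (loc S)] (hreg : IsWeaklyRegular R (List.ofFn G))
    (hrad : ∀ i, G i ∈ (Ideal.span (Set.range f)).radical) :
    ∃ Δ : torsionSections f (R ⧸ Ideal.span (Set.range G)) →ₗ[R] CechCohomology f loc n,
      Function.Injective Δ ∧ ∀ z, z ∈ LinearMap.range Δ ↔ ∀ i, G i • z = 0 := by
  have hspan : Ideal.span (Set.range G) = (Ideal.ofList (List.ofFn G) • ⊤ : Submodule R R) := by
    rw [smul_eq_mul, Ideal.mul_top, Ideal.ofList]
    congr 1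
    ext r
    simp
  have hexists := exists_torsionSections_quotient_to_cechCohomology (loc := loc) hreg
    (List.forall_mem_ofFn_iff.2 hrad)
  rw [List.length_ofFn] at hexists
  obtain ⟨Δ, hΔ, hΔr⟩ := hexists
  let e := torsionSectionsCongr f (Submodule.quotEquivOfEq _ _ hspan)
  refine ⟨Δ ∘ₗ e.toLinearMap, hΔ.comp e.injective, fun z => ?_⟩
  rw [LinearMap.range_comp_of_range_eq_top _ e.range, hΔr, List.forall_mem_ofFn_iff]

theorem nonempty_commonKer_lcMul_equiv (K : Type u) [Field K] [Algebra K R]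
    (hreg : IsWeaklyRegular R (List.ofFn G))
    (hrad : ∀ i, G i ∈ (Ideal.span (Set.range f)).radical) :
    Nonempty (commonKer (fun i => lcMul K f n (G i)) Finset.univ ≃ₗ[K]
      torsionSections f (R ⧸ Ideal.span (Set.range G))) := by
  obtain ⟨Δ, hΔ, hΔr⟩ :=
    exists_torsionSections_span_to_cechCohomology (loc := cechMap f) hreg hrad
  let Ψ := (lcEquiv K f n).symm.toLinearMap ∘ₗ Δ.restrictScalars K
  have hΨ : Function.Injective Ψ := (lcEquiv K f n).symm.injective.comp hΔ
  have hrange : LinearMap.range Ψ = commonKer (fun i => lcMul K f n (G i)) Finset.univ := by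
    ext z
    have hz : z ∈ LinearMap.range Ψ ↔ lcEquiv K f n z ∈ LinearMap.range Δ :=
      exists_congr fun y => (lcEquiv K f n).symm_apply_eq
    simp [hz, hΔr, mem_commonKer, ← lcEquiv_lcMul]
  exact ⟨(LinearEquiv.ofInjective Ψ hΨ ≪≫ₗ LinearEquiv.ofEq _ _ hrange).symm⟩

theorem exists_aeval_lcMul_pow_eq_zero {K : Type u} [Field K] [Algebra K R] {g : Polynomial K}
    {r : R} (hr : Polynomial.aeval r g ∈ (Ideal.span (Set.range f)).radical) (p : ℕ)
    (z : LocalCohomology K f p) : ∃ k, Polynomial.aeval (lcMul K f p r) (g ^ k) z = 0 := by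
  obtain ⟨k, hk⟩ := exists_pow_smul_eq_zero_of_mem_radical f (cechMap f) hr (lcEquiv K f p z)
  refine ⟨k, (lcEquiv K f p).injective ?_⟩
  rw [Polynomial.aeval_algHom_apply, map_pow, lcEquiv_lcMul, hk, map_zero]

end CommonKernel

section Partial

open MvPolynomial

theorem pderiv_pderiv_comm {A σ : Type*} [CommRing A] (i j : σ) (r : MvPolynomial σ A) :
    pderiv i (pderiv j r) = pderiv j (pderiv i r) := by
  classical
  have hbracket : ⁅pderiv (R := A) i, pderiv (R := A) j⁆ = 0 :=
    MvPolynomial.derivation_ext fun k => by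
      simp [Derivation.commutator_apply, pderiv_X, Pi.single_apply, apply_ite]
  rw [← sub_eq_zero, ← Derivation.commutator_apply, hbracket, Derivation.zero_apply]

variable {K : Type u} [Field K] {n s : ℕ} (f : Fin s → MvPolynomial (Fin n) K)

theorem weylRelations_lcMul_lcPartial (p : ℕ) :
    WeylRelations (fun i => lcMul K f p (X i)) (lcPartial f p) where
  commute_x i j := (Commute.all (X i) (X j)).map (lcMul K f p)
  commute_d i j := LinearMap.ext fun z => lcDerivation_comm f (pderiv_pderiv_comm i j) p z
  commute_d_x i j hij := LinearMap.ext fun z => by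
    simpa [lcPartial, pderiv_X_of_ne hij.symm] using lcDerivation_lcMul f (pderiv i) p (X j) z
  commutator_d_x i := LinearMap.ext fun z => sub_eq_iff_eq_add'.2 <| by
    simpa [lcPartial] using lcDerivation_lcMul f (pderiv i) p (X i) z

theorem nonempty_deRhamCohomology_lcPartial_top_equiv [CharZero K] {g : Fin n → Polynomial K}
    (hmonic : ∀ i, (g i).Monic) (hsep : ∀ i, (g i).Separable)
    (hrad : ∀ i, Polynomial.aeval (X i) (g i) ∈ (Ideal.span (Set.range f)).radical) :
    Nonempty (DeRhamCohomology (lcPartial f n) n ≃ₗ[K] MvPolynomial (Fin n) K ⧸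
      (Ideal.span (Set.range fun i => Polynomial.aeval (X i) (g i)) ⊔
        Ideal.span (Set.range f))) := by
  set J := Ideal.span (Set.range fun i => Polynomial.aeval (X i : MvPolynomial (Fin n) K) (g i))
  have hunramified : Algebra.FormallyUnramified K (MvPolynomial (Fin n) K ⧸ J) :=
    formallyUnramified_quotient_of_separable hsep fun i => Ideal.subset_span ⟨i, rfl⟩
  have hreduced : IsReduced (MvPolynomial (Fin n) K ⧸ J) :=
    Algebra.FormallyUnramified.isReduced_of_field K _
  have hfinite : Module.Finite K (MvPolynomial (Fin n) K ⧸ J) :=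
    Algebra.FormallyUnramified.finite_of_free K _
  have hartinian : IsArtinianRing (MvPolynomial (Fin n) K ⧸ J) :=
    isArtinian_of_tower K inferInstance
  have hcompl := (weylRelations_lcMul_lcPartial f n).isCompl_commonKer_rangeSum hsep
    (fun i => exists_aeval_lcMul_pow_eq_zero (hrad i) n) Finset.univ
  simp only [Polynomial.aeval_algHom_apply] at hcompl
  obtain ⟨eker⟩ := nonempty_commonKer_lcMul_equiv K (isWeaklyRegular_ofFn_aeval_X hmonic) hrad
  obtain ⟨esections⟩ := nonempty_torsionSections_quotient_equiv f J
  exact ⟨deRhamCohomologyTopEquiv (lcPartial f n) ≪≫ₗ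
    Submodule.quotientEquivOfIsCompl _ _ hcompl.symm ≪≫ₗ eker ≪≫ₗ esections.restrictScalars K⟩

end Partial

end DeRhamLC

end

open DeRhamLC MvPolynomial in
theorem theorem1 {K : Type u} [Field K] [CharZero K] {L : Type v} [Field L] [Algebra K L]
    [IsAlgClosed L] {n : ℕ} (I : Ideal (MvPolynomial (Fin n) K))
    (hI : DeRhamLC.IsZeroDimensional I)
    {s : ℕ} (f : Fin s → MvPolynomial (Fin n) K) (hf : Ideal.span (Set.range f) = I) :
    (∀ i < n, Subsingleton (DeRhamLC.DeRhamCohomology (DeRhamLC.lcPartial f n) i)) ∧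
    (MvPolynomial.zeroLocus L I).Finite ∧
    Module.Finite K (DeRhamLC.DeRhamCohomology (DeRhamLC.lcPartial f n) n) ∧
    Module.finrank K (DeRhamLC.DeRhamCohomology (DeRhamLC.lcPartial f n) n) =
      (MvPolynomial.zeroLocus L I).ncard := by
  have hquot := finite_quotient_of_isZeroDimensional K hI
  choose g hmonic hsep hgI using fun i => exists_separable_aeval_mem_radical (K := K) I (X i)
  subst hf
  set J := Ideal.span (Set.range fun i => Polynomial.aeval (X i : MvPolynomial (Fin n) K) (g i))
  have hJ : J ≤ (Ideal.span (Set.range f)).radical :=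
    Ideal.span_le.2 (Set.range_subset_iff.2 hgI)
  have hunramified := formallyUnramified_quotient_of_separable hsep fun i =>
    (le_sup_left : J ≤ J ⊔ Ideal.span (Set.range f)) (Ideal.subset_span ⟨i, rfl⟩)
  have hfinite := Algebra.FormallyUnramified.finite_of_free K
    (MvPolynomial (Fin n) K ⧸ (J ⊔ Ideal.span (Set.range f)))
  have hreduced := Algebra.FormallyUnramified.isReduced_of_field K
    (MvPolynomial (Fin n) K ⧸ (J ⊔ Ideal.span (Set.range f)))
  have hweyl := weylRelations_lcMul_lcPartial f n
  have htors := fun i => exists_aeval_lcMul_pow_eq_zero (hgI i) n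
  obtain ⟨e⟩ := nonempty_deRhamCohomology_lcPartial_top_equiv f hmonic hsep hgI
  refine ⟨fun p hp => subsingleton_deRhamCohomology hweyl.commute_d
    (hweyl.isWeaklyRegularOn hsep htors Finset.univ) hp, finite_zeroLocus _,
    Module.Finite.equiv e.symm, ?_⟩
  rw [e.finrank_eq, ← zeroLocus_sup_eq hJ, ncard_zeroLocus_eq_finrank]
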